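/- Conventions. A metric measure space is a metric space $(X,\mathrm{dist})$ with a $\sigma$-finite Borel measure $\mu$. $B(x,r)$ is the open ball. For $h>0$ and $A\subset X$ let $A_h=\{x:\mathrm{dist}(x,A)\le h\}$ (with $\emptyset_h=\emptyset$) and $\partial_hA=A_h\cap(A^c)_h$. The $h$-profile is $I_h(t)=\inf\{\mu(\partial_hA): A\ \mu\text{-measurable},\ t\le\mu(A)<\infty\}$, and for a family $\mathcal A$ of sets $I^{\downarrow}_{h,\mathcal A}(t)=\inf\{\mu(\partial_hA):A\in\mathcal A,\ \mu(A)\ge t\}$. Write $f\preceq g$ if there are $C_1,C_2>0$ with $f(t)\le C_1g(C_2t)$ for all $t>0$. The family $\mathcal A$ is asymptotically isoperimetric (for $\partial_h$) if $I^{\downarrow}_{h,\mathcal A}\preceq I_h$. A sequence $(A_n)$ of measurable sets of finite, unbounded measure is isoperimetric if $\{A_n\}$ is asymptotically isoperimetric. $X$ has polynomial growth of degree $d$ if for some $C\ge1$, $C^{-1}r^d\le\mu(B(x,r))\le Cr^d$ for all $x\in X$, $r\ge1$. $X$ is $(DV)_{loc}$ if for every $r>0$ there is $C_r$ with $\mu(B(x,2r))\le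 C_r\,\mu(B(x,r))$ for all $x$. $X$ is uniformly $b$-connected if for every $E_1>0$ there is $E_2\geq E_1$ such that any $x,y$ with $\mathrm{dist}(x,y)\le E_1$ are joined by a finite chain in $B(x,E_2)$ with steps of length $\le b$; a scale $h$ is admissible for $X$ if $h\ge 2b$ for some $b>0$ such that $X$ is uniformly $b$-connected. $X$ is (NIB) if it has admissible scales and, for every admissible $h$, the family of all balls is not asymptotically isoperimetric for $\partial_h$. $X$ is an (M)-space if there is $C\ge1$ with $\mathrm{dist}(y,B(x,r))\le C$ for all $x\in X$, $r>0$, $y\in B(x,r+1)$. Two $(DV)_{loc}$ spaces $(X,\mu)$, $(X',\mu')$ are large-scale equivalent if there are $f:X\to X'$ and constants $C_1>0$, $C_2,C_3\ge1$ with $f(X)_{C_1}=X'$, $C_2^{-1}\mathrm{dist}(x,y)-C_2\le \mathrm{dist}(f(x),f(y))\le C_2\,\mathrm{dist}(x,y)+C_2$ and $C_3^{-1}\mu(B(x,1))\le\mu'(B(f(x),1))\le C_3\,\mu(B(x,1))$ for all $x,y\in X$. $X$ is stably-(NIB) if every (M)-space large-scale equivalent to $X$ is (NIB). A connected graph is viewed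 as the metric measure space of its vertices with the graph distance and the counting measure. Theorem. For every integer $d\ge2$ there is a connected graph $X$ such that: (1) $X$ has polynomial growth of degree $d$; (2) the profile of $X$ is unbounded: $\sup_t I_h(t)=\infty$ for every $h\ge1$; (3) $X$ is stably-(NIB); (4) for every $h\ge1$ and every isoperimetric sequence $(A_n)$ for $\partial_h$ in $X$, there are no balls $B(x_n,r_n)$, $B(x_n',r_n')$ with $r_n>0$, $r_n'/r_n$ bounded and $B(x_n,r_n)\subset A_n\subset B(x_n',r_n')$ for all $n$; (5) every metric measure space $(X',\mu')$ large-scale equivalent to $X$, (M) or not, is (NIB), and its spheres have volume of order $r^{d-1}$ in the following sense: for every admissible scale $h$ of $X'$ there is $C\ge1$ such that for all $x\in X'$ and $r\ge1$ $$\mu'(\partial_hB(x,r))\ge C^{-1}r^{d-1}\quad\text{and}\quad \mu'(\partial_hB(x,s))\le C\,r^{d-1}\ \text{ for some } s\in[r,2r];$$ in particular $\inf_{s\ge r}\mu'(\partial_hB(x,s))\approx r^{d-1}$. -/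

import Mathlib

open MeasureTheory Metric Set
open scoped ENNReal NNReal

universe u v

noncomputable section

namespace Isoperimetry

/-! Metric measure spaces: a metric space with its Borel sigma-algebra and a sigma-finite measure. -/

/-- The `h`-boundary `A_h ∩ (Aᶜ)_h`, where `A_h` is the set of points at distance at most `h`
from `A` (and `∅_h = ∅`). -/
def bdry {X : Type u} [MetricSpace X] (h : ℝ) (A : Set X) : Set X :=
  cthickening h A ∩ cthickening h Aᶜ

/-- The `h`-profile `I_h(t) = inf { μ(∂_h A) : A μ-measurable, μ(A) < ∞, μ(A) ≥ t }`. -/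
def profile {X : Type u} [MetricSpace X] [MeasurableSpace X] (μ : Measure X) (h t : ℝ) : ℝ≥0∞ :=
  ⨅ (A : Set X) (_ : NullMeasurableSet A μ) (_ : μ A < ∞) (_ : ENNReal.ofReal t ≤ μ A),
    μ (bdry h A)

/-- The lower `h`-profile restricted to a family of sets. -/
def lowerProfile {X : Type u} [MetricSpace X] [MeasurableSpace X] (μ : Measure X) (h : ℝ)
    (𝒜 : Set (Set X)) (t : ℝ) : ℝ≥0∞ :=
  ⨅ (A : Set X) (_ : A ∈ 𝒜) (_ : ENNReal.ofReal t ≤ μ A), μ (bdry h A)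

/-- The relation `f ⪯ g`. -/
def Preceq (f g : ℝ → ℝ≥0∞) : Prop :=
  ∃ C₁ C₂ : ℝ, 0 < C₁ ∧ 0 < C₂ ∧ ∀ t : ℝ, 0 < t → f t ≤ ENNReal.ofReal C₁ * g (C₂ * t)

/-- A family is asymptotically isoperimetric (for `h`-boundaries). -/
def AsympIsoperimetric {X : Type u} [MetricSpace X] [MeasurableSpace X] (μ : Measure X) (h : ℝ)
    (𝒜 : Set (Set X)) : Prop :=
  Preceq (lowerProfile μ h 𝒜) (profile μ h)

/-- Isoperimetric sequences: measurable sets of finite, unbounded volume, forming an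
asymptotically isoperimetric family. -/
def IsoperimetricSequence {X : Type u} [MetricSpace X] [MeasurableSpace X] (μ : Measure X) (h : ℝ)
    (A : ℕ → Set X) : Prop :=
  (∀ n, NullMeasurableSet (A n) μ ∧ μ (A n) < ∞) ∧
  (∀ M : ℝ≥0, ∃ n, (M : ℝ≥0∞) ≤ μ (A n)) ∧
  AsympIsoperimetric μ h (Set.range A)

/-- The sequence `A` is squeezed between balls of comparable radii. -/
def SandwichedByBalls {X : Type u} [MetricSpace X] (A : ℕ → Set X) : Prop :=
  ∃ (x x' : ℕ → X) (r r' : ℕ → ℝ) (C : ℝ),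
    (∀ n, 0 < r n) ∧ (∀ n, r' n / r n ≤ C) ∧
    ∀ n, ball (x n) (r n) ⊆ A n ∧ A n ⊆ ball (x' n) (r' n)

/-- The profile at scale `h` is unbounded. -/
def UnboundedProfile {X : Type u} [MetricSpace X] [MeasurableSpace X] (μ : Measure X) (h : ℝ) :
    Prop :=
  ∀ M : ℝ≥0, ∃ t : ℝ, 0 < t ∧ (M : ℝ≥0∞) < profile μ h t

/-- Doubling at fixed radius. -/
def DVloc {X : Type u} [MetricSpace X] [MeasurableSpace X] (μ : Measure X) : Prop :=
  ∀ r : ℝ, 0 < r → ∃ C : ℝ≥0, ∀ x : X, μ (ball x (2 * r)) ≤ C * μ (ball x r)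

/-- (Strict) polynomial growth of degree `d`. -/
def PolynomialGrowth {X : Type u} [MetricSpace X] [MeasurableSpace X] (μ : Measure X) (d : ℕ) :
    Prop :=
  ∃ C : ℝ, 1 ≤ C ∧ ∀ (x : X) (r : ℝ), 1 ≤ r →
    ENNReal.ofReal (C⁻¹ * r ^ d) ≤ μ (ball x r) ∧ μ (ball x r) ≤ ENNReal.ofReal (C * r ^ d)

/-- Uniform `b`-connectedness: points at distance at most `E₁` are joined by a `b`-chain that stays
in a ball whose radius depends on `E₁` only. (The condition for large `E₁` implies it for the
smaller ones, so it is asked for all `E₁ > 0`.) -/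
def UniformlyConnected (X : Type u) [MetricSpace X] (b : ℝ) : Prop :=
  ∀ E₁ : ℝ, 0 < E₁ → ∃ E₂ : ℝ, E₁ ≤ E₂ ∧ ∀ x y : X, dist x y ≤ E₁ →
    ∃ (n : ℕ) (c : ℕ → X), c 0 = x ∧ c n = y ∧
      (∀ i < n, dist (c i) (c (i + 1)) ≤ b) ∧ ∀ i ≤ n, c i ∈ ball x E₂

/-- The scales `h` at which the boundary is meaningful: `h ≥ 2b` for some `b` such that the space
is uniformly `b`-connected. -/
def AdmissibleScale (X : Type u) [MetricSpace X] (h : ℝ) : Prop :=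
  ∃ b : ℝ, 0 < b ∧ UniformlyConnected X b ∧ 2 * b ≤ h

/-- Property (M) (monotone geodesicity). -/
def PropertyM (X : Type u) [MetricSpace X] : Prop :=
  ∃ C : ℝ, 1 ≤ C ∧ ∀ (x : X) (r : ℝ), 0 < r → ∀ y ∈ ball x (r + 1), infDist y (ball x r) ≤ C

/-- `f` is a quasi-isometry with constants `C₁`, `C₂`. -/
def QuasiIsometry {X : Type u} {Y : Type v} [MetricSpace X] [MetricSpace Y] (C₁ C₂ : ℝ)
    (f : X → Y) : Prop :=
  cthickening C₁ (Set.range f) = Set.univ ∧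
  ∀ x y : X, C₂⁻¹ * dist x y - C₂ ≤ dist (f x) (f y) ∧ dist (f x) (f y) ≤ C₂ * dist x y + C₂

/-- Large-scale equivalence of two metric measure spaces that are doubling at fixed radius. -/
def LargeScaleEquivalent {X : Type u} {Y : Type v} [MetricSpace X] [MeasurableSpace X]
    [MetricSpace Y] [MeasurableSpace Y] (μ : Measure X) (ν : Measure Y) : Prop :=
  DVloc μ ∧ DVloc ν ∧
  ∃ (f : X → Y) (C₁ C₂ : ℝ) (C₃ : ℝ≥0), 0 < C₁ ∧ 1 ≤ C₂ ∧ 1 ≤ C₃ ∧ QuasiIsometry C₁ C₂ f ∧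
    ∀ x : X, (C₃ : ℝ≥0∞)⁻¹ * μ (ball x 1) ≤ ν (ball (f x) 1) ∧
      ν (ball (f x) 1) ≤ C₃ * μ (ball x 1)

/-- The family of all balls. -/
def balls (X : Type u) [MetricSpace X] : Set (Set X) :=
  {B | ∃ (x : X) (r : ℝ), 0 < r ∧ B = ball x r}

/-- (NIB): the space is uniformly connected, and balls are not asymptotically isoperimetric,
whichever admissible scale `h` is used to define the boundary. -/
def NIB {X : Type u} [MetricSpace X] [MeasurableSpace X] (μ : Measure X) : Prop :=
  (∃ h, AdmissibleScale X h) ∧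
  ∀ h, AdmissibleScale X h → ¬ AsympIsoperimetric μ h (balls X)

/-- Stably-(NIB): every (M)-space large-scale equivalent to the given space is (NIB). -/
def StablyNIB {X : Type u} [MetricSpace X] [MeasurableSpace X] (μ : Measure X) : Prop :=
  ∀ (Y : Type v) [MetricSpace Y] [MeasurableSpace Y] [BorelSpace Y] (ν : Measure Y) [SigmaFinite ν],
    PropertyM Y → LargeScaleEquivalent μ ν → NIB ν

/-- The volume of spheres grows like `r ^ k`, uniformly in the center: every sphere of radius `r`
has volume at least `C⁻¹ r ^ k`, and some sphere with radius
in `[r, 2r]` has volume at most `C r ^ k`. In particular `inf_{s ≥ r} μ(∂_h B(x, s)) ≈ r ^ k`. -/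
def SphereGrowth {X : Type u} [MetricSpace X] [MeasurableSpace X] (μ : Measure X) (h : ℝ)
    (k : ℕ) : Prop :=
  ∃ C : ℝ, 1 ≤ C ∧ ∀ (x : X) (r : ℝ), 1 ≤ r →
    ENNReal.ofReal (C⁻¹ * r ^ k) ≤ μ (bdry h (ball x r)) ∧
    ∃ s ∈ Set.Icc r (2 * r), μ (bdry h (ball x s)) ≤ ENNReal.ofReal (C * r ^ k)

/-- The metric of `V` is the graph distance of the connected graph `G`. -/
def IsGraphMetric {V : Type u} [MetricSpace V] (G : SimpleGraph V) : Prop :=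
  G.Connected ∧ ∀ x y : V, dist x y = (G.dist x y : ℝ)

end Isoperimetry

end

/-! Take ℤ × ℤ^(d-1) and, for each k, remove the vertical edges leaving height 2^k, except at doors
placed on the sublattice 2^k ℤ^(d-1). A detour to a door costs about as much as the height of its
wall, and walls are sparse on the logarithmic scale. So each ball of radius r still contains a cube
of side comparable to r (`exists_box`), and growth stays of degree d.

Put d = e + 2 and q = 2^k. The slab between the walls at heights q and 2q, of width q^2, has volume
q^(2e+3). Its walls leak only through few doors, so its boundary is governed by the lateral faces,
of size q^(2e+1) (`exists_innerBdry_slab_subset`). On the other hand, horizontal lines meet no wall,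
so a finite set containing a ball of radius r has at least c r^(e+1) boundary points
(`ballIsoperimetry`). Hence balls, and sets squeezed between balls of comparable radii, satisfy |∂A|
≳ |A|^((e+1)/(e+2)). Since (2e+1)(e+2) < (e+1)(2e+3), slabs beat them by an unbounded factor
(`not_asympIsoperimetric`).

Both estimates survive quasi-isometries. The lower bound concerns every finite set containing a
ball, so it applies to the preimage of a ball of the target, whatever its shape
(`exists_le_measure_bdry_ball`). Slabs are carried to the target with comparable volume and boundary
(`exists_transfer`). The upper bound on spheres is a pigeonhole over disjoint concentric spheres. -/

noncomputable section

namespace Isoperimetry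

/-! ### The lattice with walls and its distance -/

/-- The vertices of the lattice `ℤ × ℤ ^ e`, split into a height and a horizontal position. -/
@[ext]
structure WallLattice (e : ℕ) where
  /-- the vertical coordinate -/
  height : ℤ
  /-- the horizontal coordinates -/
  pos : Fin e → ℤ

namespace WallLattice

variable {e : ℕ}

/-- The vertical edge from height `n` to height `n + 1` over `v` is present unless there is a wall
at height `n`. Walls are at the heights `2 ^ k`, and the wall at height `2 ^ k` has doors at the
points of `2 ^ k ℤ ^ e`. -/
def IsOpenAt (n : ℤ) (v : Fin e → ℤ) : Prop :=
  ∀ k : ℕ, n = 2 ^ k → ∀ i, (2 ^ k : ℤ) ∣ v i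

/-- The oriented edges of the lattice with walls. -/
def Step (x y : WallLattice e) : Prop :=
  (y.height = x.height ∧ ∃ i, y.pos = Function.update x.pos i (x.pos i + 1)) ∨
  (y.height = x.height + 1 ∧ y.pos = x.pos ∧ IsOpenAt x.height x.pos)

/-- The lattice with walls. -/
def graph (e : ℕ) : SimpleGraph (WallLattice e) := SimpleGraph.fromRel Step

lemma adj_iff {x y : WallLattice e} : (graph e).Adj x y ↔ x ≠ y ∧ (Step x y ∨ Step y x) :=
  SimpleGraph.fromRel_adj _ _ _

lemma edist_le_one_of_step {x y : WallLattice e} (h : Step x y) : (graph e).edist x y ≤ 1 := by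
  rw [SimpleGraph.edist_le_one_iff_adj_or_eq, adj_iff]
  tauto

lemma edist_add_le {x y z : WallLattice e} {a b : ℕ} (h : (graph e).edist x y ≤ a)
    (h' : (graph e).edist y z ≤ b) : (graph e).edist x z ≤ (a + b : ℕ) := by
  refine ((graph e).edist_triangle (v := y)).trans ?_
  push_cast
  exact add_le_add h h'

lemma edist_column (v : Fin e → ℤ) (n : ℤ) (j : ℕ) (h : ∀ i : ℕ, i < j → IsOpenAt (n + i) v) :
    (graph e).edist ⟨n, v⟩ ⟨n + j, v⟩ ≤ j := by
  induction j with
  | zero => simp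
  | succ j ih =>
    refine edist_add_le (ih fun i hi => h i (by omega)) (edist_le_one_of_step (Or.inr ⟨?_, rfl, ?_⟩))
    · push_cast; ring
    · exact h j (by omega)

lemma edist_update_add (n : ℤ) (v : Fin e → ℤ) (i : Fin e) (j : ℕ) :
    (graph e).edist ⟨n, v⟩ ⟨n, Function.update v i (v i + j)⟩ ≤ j := by
  induction j with
  | zero => simp
  | succ j ih =>
    refine edist_add_le ih (edist_le_one_of_step (Or.inl ⟨rfl, i, ?_⟩))
    simp [add_assoc]

lemma edist_update (n : ℤ) (v : Fin e → ℤ) (i : Fin e) (a : ℤ) :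
    (graph e).edist ⟨n, v⟩ ⟨n, Function.update v i a⟩ ≤ (a - v i).natAbs := by
  rcases le_total (v i) a with h | h
  · have := edist_update_add n v i (a - v i).natAbs
    rwa [show v i + ((a - v i).natAbs : ℤ) = a by omega] at this
  · have := edist_update_add n (Function.update v i a) i (a - v i).natAbs
    rw [Function.update_self, show a + ((a - v i).natAbs : ℤ) = v i by omega,
      Function.update_idem, Function.update_eq_self] at this
    rwa [SimpleGraph.edist_comm]

/-- The coordinates are corrected one at a time; no wall interferes with horizontal motion. -/
lemma edist_horizontal (n : ℤ) (v w : Fin e → ℤ) (L : ℕ) (h : ∀ i, (w i - v i).natAbs ≤ L) :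
    (graph e).edist ⟨n, v⟩ ⟨n, w⟩ ≤ (e * L : ℕ) := by
  have key : ∀ s : Finset (Fin e), (graph e).edist ⟨n, v⟩ ⟨n, s.piecewise w v⟩ ≤
      (s.card * L : ℕ) := by
    intro s
    induction s using Finset.induction_on with
    | empty => simp
    | insert i s hi ih =>
      rw [Finset.card_insert_of_notMem hi, add_mul, one_mul, Finset.piecewise_insert]
      refine edist_add_le ih ((edist_update _ _ _ _).trans ?_)
      rw [Finset.piecewise_eq_of_notMem _ _ _ hi]
      exact_mod_cast h i
  simpa using key Finset.univ

/-- Every wall crossed has height below 2^j, hence has a door over each point of 2^j ℤ^e. One path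
moves to such a point, goes straight down and comes back, and each horizontal trip costs at most e
2^j. -/
lemma edist_descend (v : Fin e → ℤ) (n : ℤ) (j i : ℕ) (hn : n ≤ 2 ^ j) :
    (graph e).edist ⟨n, v⟩ ⟨n - i, v⟩ ≤ (e * 2 ^ j + i + e * 2 ^ j : ℕ) := by
  set w : Fin e → ℤ := fun l => 2 ^ j * (v l / 2 ^ j) with hw
  have hpos : (0 : ℤ) < 2 ^ j := by positivity
  have hvw : ∀ l, 0 ≤ v l - w l ∧ v l - w l < 2 ^ j := fun l => by
    have h1 := Int.emod_add_mul_ediv (v l) (2 ^ j)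
    have h2 := Int.emod_nonneg (v l) hpos.ne'
    have h3 := Int.emod_lt_of_pos (v l) hpos
    simp only [hw]
    constructor <;> linarith
  have hcast : ((2 ^ j : ℕ) : ℤ) = 2 ^ j := by push_cast; rfl
  refine edist_add_le (edist_add_le (edist_horizontal n v w _ fun l => ?_) ?_)
    (edist_horizontal _ w v _ fun l => ?_)
  · have := hvw l; omega
  · rw [SimpleGraph.edist_comm]
    have := edist_column w (n - i) i fun l hl k hk m => ?_
    · simpa using this
    · have hkj : k ≤ j := by
        by_contra hcon
        have : (2 : ℤ) ^ j ≤ 2 ^ k := pow_le_pow_right₀ (by norm_num) (by omega)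
        omega
      exact (pow_dvd_pow 2 hkj).trans (Dvd.intro _ rfl)
  · have := hvw l; omega

lemma edist_ne_top (x y : WallLattice e) : (graph e).edist x y ≠ ⊤ := by
  have key : ∀ (n n' : ℤ) (v w : Fin e → ℤ), n' ≤ n → (graph e).edist ⟨n, v⟩ ⟨n', w⟩ ≠ ⊤ := by
    intro n n' v w h
    obtain ⟨i, rfl⟩ : ∃ i : ℕ, n' = n - i := ⟨(n - n').toNat, by omega⟩
    have h1 : n ≤ 2 ^ n.toNat := by
      have : n.toNat < 2 ^ n.toNat := Nat.lt_two_pow_self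
      have h' : ((2 ^ n.toNat : ℕ) : ℤ) = 2 ^ n.toNat := by push_cast; rfl
      omega
    have h2 := edist_descend v n _ i h1
    have h3 := edist_horizontal (n - i) v w (∑ l, (w l - v l).natAbs) fun l =>
      Finset.single_le_sum (f := fun l => (w l - v l).natAbs) (fun _ _ => Nat.zero_le _)
        (Finset.mem_univ l)
    exact ne_top_of_le_ne_top (ENat.natCast_ne_top _) (edist_add_le h2 h3)
  rcases le_total y.height x.height with h | h
  · exact key _ _ x.pos y.pos h
  · rw [SimpleGraph.edist_comm]
    exact key _ _ y.pos x.pos h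

lemma connected (e : ℕ) : (graph e).Connected :=
  { preconnected := fun x y => SimpleGraph.reachable_of_edist_ne_top (edist_ne_top x y)
    nonempty := ⟨⟨0, 0⟩⟩ }

instance : MetricSpace (WallLattice e) where
  dist x y := ((graph e).dist x y : ℝ)
  dist_self x := by simp
  dist_comm x y := by rw [SimpleGraph.dist_comm]
  dist_triangle x y z := by exact_mod_cast (connected e).dist_triangle
  eq_of_dist_eq_zero h := (connected e).dist_eq_zero_iff.1 (by exact_mod_cast h)

lemma isGraphMetric (e : ℕ) : IsGraphMetric (graph e) := ⟨connected e, fun _ _ => rfl⟩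

lemma dist_le_of_edist_le {x y : WallLattice e} {L : ℕ} (h : (graph e).edist x y ≤ L) :
    dist x y ≤ L := by
  change ((graph e).dist x y : ℝ) ≤ L
  rw [← ((connected e) x y).coe_dist_eq_edist] at h
  exact_mod_cast h

/-- Around each vertex at scale `m` one finds a cube of side `m` with one corner on the vertical
line through the vertex. -/
lemma exists_box (n : ℤ) (v : Fin e → ℤ) (m : ℕ) :
    ∃ n₀ : ℤ, ∀ y : WallLattice e, n₀ ≤ y.height → y.height ≤ n₀ + m →
      (∀ i, v i ≤ y.pos i ∧ y.pos i ≤ v i + m) →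
      dist (⟨n, v⟩ : WallLattice e) y ≤ ((17 * e + 1) * m : ℕ) := by
  suffices H : ∃ n₀ : ℤ, ∀ n' : ℤ, n₀ ≤ n' → n' ≤ n₀ + m →
      (graph e).edist ⟨n, v⟩ ⟨n', v⟩ ≤ ((16 * e + 1) * m : ℕ) by
    obtain ⟨n₀, h⟩ := H
    refine ⟨n₀, fun y h1 h2 h3 => dist_le_of_edist_le ?_⟩
    have := edist_add_le (h y.height h1 h2) (edist_horizontal y.height v y.pos m fun i => by
      have := h3 i; omega)
    rwa [show (17 * e + 1) * m = (16 * e + 1) * m + e * m by ring]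
  rcases Nat.eq_zero_or_pos m with rfl | hm
  · refine ⟨n, fun n' h1 h2 => ?_⟩
    obtain rfl : n' = n := by push_cast at h2; omega
    simp
  -- Low vertices: go down. The doors needed have period at most the power of two lying in (4m, 8m],
  -- so the two detours cost at most 16em in all.
  by_cases hn : n ≤ 4 * m
  · refine ⟨n - m, fun n' h1 h2 => ?_⟩
    obtain ⟨i, rfl⟩ : ∃ i : ℕ, n' = n - i := ⟨(n - n').toNat, by omega⟩
    have h3 : 4 * m < 2 ^ (Nat.log 2 (4 * m) + 1) := Nat.lt_pow_succ_log_self (by norm_num) _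
    have h4 : 2 ^ (Nat.log 2 (4 * m)) ≤ 4 * m := Nat.pow_log_le_self 2 (by omega)
    rw [pow_succ] at h3
    refine (edist_descend v n (Nat.log 2 (4 * m) + 1) i ?_).trans ?_
    · have : ((2 ^ Nat.log 2 (4 * m) : ℕ) : ℤ) = 2 ^ Nat.log 2 (4 * m) := by push_cast; rfl
      rw [pow_succ]; omega
    · have h5 : e * 2 ^ (Nat.log 2 (4 * m) + 1) ≤ e * (8 * m) :=
        Nat.mul_le_mul_left _ (by rw [pow_succ]; omega)
      have h6 : i ≤ m := by omega
      exact_mod_cast show e * 2 ^ (Nat.log 2 (4 * m) + 1) + i + e * 2 ^ (Nat.log 2 (4 * m) + 1) ≤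
        (16 * e + 1) * m by linarith
  · push Not at hn
    have hle : m ≤ (16 * e + 1) * m := Nat.le_mul_of_pos_left _ (by omega)
    -- High vertices, n > 4m. If a wall lies within m below, at height 2^k ≥ n - m, the next one has
    -- height at least 2(n - m) > n + m, so the way up is free. Otherwise the way down is free.
    by_cases hw : ∃ k : ℕ, n - m ≤ 2 ^ k ∧ (2 : ℤ) ^ k < n
    · obtain ⟨k, hk1, hk2⟩ := hw
      refine ⟨n, fun n' h1 h2 => ?_⟩
      obtain ⟨i, rfl⟩ : ∃ i : ℕ, n' = n + i := ⟨(n' - n).toNat, by omega⟩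
      refine (edist_column v n i fun l hl k' hk' => ?_).trans
        (by exact_mod_cast (show i ≤ (16 * e + 1) * m by omega))
      exfalso
      have hkk : k < k' := by
        by_contra hcon
        have : (2 : ℤ) ^ k' ≤ 2 ^ k := pow_le_pow_right₀ (by norm_num) (by omega)
        omega
      have : (2 : ℤ) ^ (k + 1) ≤ 2 ^ k' := pow_le_pow_right₀ (by norm_num) hkk
      rw [pow_succ] at this
      omega
    · push Not at hw
      refine ⟨n - m, fun n' h1 h2 => ?_⟩
      obtain ⟨i, rfl⟩ : ∃ i : ℕ, n' = n - i := ⟨(n - n').toNat, by omega⟩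
      have := edist_column v (n - i) i fun l hl k' hk' => ?_
      · rw [SimpleGraph.edist_comm]
        refine (le_of_eq_of_le (by simp) this).trans
          (by exact_mod_cast (show i ≤ (16 * e + 1) * m by omega))
      · exfalso
        have := hw k' (by omega)
        omega

/-- A function that changes by at most one along edges is `1`-Lipschitz. -/
lemma abs_sub_le_dist (g : WallLattice e → ℤ) (hg : ∀ x y, Step x y → |g y - g x| ≤ 1)
    (x y : WallLattice e) : |((g x - g y : ℤ) : ℝ)| ≤ dist x y := by
  have key : ∀ (x y : WallLattice e) (p : (graph e).Walk x y), |g x - g y| ≤ p.length := by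
    intro x y p
    induction p with
    | nil => simp
    | @cons a b c hab p ih =>
      have h1 : |g a - g b| ≤ 1 := by
        rcases (adj_iff.1 hab).2 with h | h
        · rw [abs_sub_comm]; exact hg _ _ h
        · exact hg _ _ h
      have := abs_sub_le (g a) (g b) (g c)
      rw [SimpleGraph.Walk.length_cons]
      push_cast
      omega
  obtain ⟨p, hp⟩ := (connected e).exists_walk_length_eq_dist x y
  change _ ≤ ((graph e).dist x y : ℝ)
  rw [← hp]
  exact_mod_cast key x y p

lemma abs_height_sub_le (x y : WallLattice e) :
    |((x.height - y.height : ℤ) : ℝ)| ≤ dist x y := by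
  refine abs_sub_le_dist (fun x => x.height) (fun x y h => ?_) x y
  rcases h with ⟨h, -⟩ | ⟨h, -⟩ <;> simp [h]

lemma abs_pos_sub_le (x y : WallLattice e) (i : Fin e) :
    |((x.pos i - y.pos i : ℤ) : ℝ)| ≤ dist x y := by
  refine abs_sub_le_dist (fun x => x.pos i) (fun x y h => ?_) x y
  rcases h with ⟨-, j, h⟩ | ⟨-, h, -⟩
  · rcases eq_or_ne i j with rfl | hij
    · simp [h]
    · simp [h, Function.update_of_ne hij]
  · simp [h]

/-- The product of a finite set of heights and a finite set of positions. -/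
def prodFinset (s : Finset ℤ) (t : Finset (Fin e → ℤ)) : Finset (WallLattice e) :=
  (s ×ˢ t).map ⟨fun p => ⟨p.1, p.2⟩, fun p q h => by
    simp only [WallLattice.mk.injEq] at h
    exact Prod.ext h.1 h.2⟩

@[simp]
lemma mem_prodFinset {s : Finset ℤ} {t : Finset (Fin e → ℤ)} {x : WallLattice e} :
    x ∈ prodFinset s t ↔ x.height ∈ s ∧ x.pos ∈ t := by
  constructor
  · simp only [prodFinset, Finset.mem_map]
    rintro ⟨p, hp, rfl⟩
    exact Finset.mem_product.1 hp
  · intro h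
    exact Finset.mem_map.2 ⟨(x.height, x.pos), by simpa using h, rfl⟩

@[simp]
lemma card_prodFinset (s : Finset ℤ) (t : Finset (Fin e → ℤ)) :
    (prodFinset s t).card = s.card * t.card := by
  simp [prodFinset]

end WallLattice

/-! ### Growth and isoperimetry of balls in the lattice -/

/-- The vertices of `A` that have a neighbour outside `A`. -/
def innerBdry {V : Type u} (G : SimpleGraph V) (A : Set V) : Set V :=
  {z | z ∈ A ∧ ∃ w, w ∉ A ∧ G.Adj z w}

lemma IsGraphMetric.ball_one {V : Type u} [MetricSpace V] {G : SimpleGraph V}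
    (hG : IsGraphMetric G) (x : V) : ball x 1 = {x} := by
  ext y
  rw [mem_ball, hG.2, mem_singleton_iff]
  constructor
  · intro h
    exact hG.1.dist_eq_zero_iff.1 (by exact_mod_cast Nat.lt_one_iff.1 (by exact_mod_cast h))
  · rintro rfl; simp

/-- Finite sets containing a ball of radius `r` have at least `c * r ^ k` boundary points. -/
def BallIsoperimetry {V : Type u} [MetricSpace V] (G : SimpleGraph V) (k : ℕ) : Prop :=
  ∃ c : ℝ, 0 < c ∧ ∀ (x : V) (r : ℝ), 0 < r → ∀ A : Set V, A.Finite → ball x r ⊆ A →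
    ∃ S : Finset V, ↑S ⊆ innerBdry G A ∧ c * r ^ k ≤ S.card

namespace WallLattice

variable {e : ℕ}

instance : MeasurableSpace (WallLattice e) := ⊤

instance : DiscreteTopology (WallLattice e) :=
  discreteTopology_iff_isOpen_singleton.2 fun x => by
    rw [← (isGraphMetric e).ball_one x]
    exact isOpen_ball

instance : BorelSpace (WallLattice e) := ⟨by
  rw [borel_eq_top_of_discrete]; rfl⟩

lemma ball_subset_prodFinset (x : WallLattice e) (r : ℝ) :
    ball x r ⊆ prodFinset (Finset.Icc (x.height - ⌊r⌋₊) (x.height + ⌊r⌋₊))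
      (Fintype.piFinset fun i => Finset.Icc (x.pos i - ⌊r⌋₊) (x.pos i + ⌊r⌋₊)) := by
  intro y hy
  rw [mem_ball] at hy
  have key : ∀ a b : ℤ, |((a - b : ℤ) : ℝ)| ≤ dist y x → b - ⌊r⌋₊ ≤ a ∧ a ≤ b + ⌊r⌋₊ := by
    intro a b h
    have : (a - b).natAbs ≤ ⌊r⌋₊ := Nat.le_floor (by
      rw [Nat.cast_natAbs]; push_cast at h ⊢; linarith)
    omega
  rw [Finset.mem_coe, mem_prodFinset, Fintype.mem_piFinset, Finset.mem_Icc]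
  exact ⟨key _ _ (abs_height_sub_le y x), fun i => Finset.mem_Icc.2 (key _ _ (abs_pos_sub_le y x i))⟩

lemma count_ball_le (x : WallLattice e) {r : ℝ} (hr : 1 ≤ r) :
    (Measure.count : Measure (WallLattice e)) (ball x r) ≤
      ENNReal.ofReal (3 ^ (e + 1) * r ^ (e + 1)) := by
  refine (measure_mono (ball_subset_prodFinset x r)).trans ?_
  rw [Measure.count_apply_finset, card_prodFinset, Fintype.card_piFinset,
    ← ENNReal.ofReal_natCast]
  refine ENNReal.ofReal_le_ofReal ?_
  have h1 : ∀ a : ℤ, (Finset.Icc (a - ⌊r⌋₊) (a + ⌊r⌋₊)).card = 2 * ⌊r⌋₊ + 1 := by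
    intro a; rw [Int.card_Icc]; omega
  simp only [h1, Finset.prod_const, Finset.card_univ, Fintype.card_fin]
  rw [← pow_succ', ← mul_pow]
  push_cast
  have := Nat.floor_le (by linarith : (0 : ℝ) ≤ r)
  gcongr
  linarith

/-- Each ball contains a cube of comparable size. -/
lemma exists_box_subset_ball (x : WallLattice e) {r : ℝ} (hr : 0 < r) :
    ∃ (m : ℕ) (n₀ : ℤ), r ≤ (17 * e + 1) * (m + 1) ∧
      ↑(prodFinset (Finset.Icc n₀ (n₀ + m))
        (Fintype.piFinset fun i => Finset.Icc (x.pos i) (x.pos i + m))) ⊆ ball x r := by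
  have hK : (0 : ℝ) < 17 * e + 1 := by positivity
  have hc : 0 < ⌈r / (17 * e + 1)⌉₊ := Nat.ceil_pos.2 (by positivity)
  -- Writing the ceiling as m + 1 gives m < r / (17e + 1) ≤ m + 1: the strict side puts the cube in
  -- the open ball, the other one bounds r. For small r the cube is one point.
  obtain ⟨m, hm⟩ : ∃ m, ⌈r / (17 * e + 1)⌉₊ = m + 1 := ⟨_, (Nat.succ_pred_eq_of_pos hc).symm⟩
  obtain ⟨n₀, h⟩ := exists_box x.height x.pos m
  refine ⟨m, n₀, ?_, fun y hy => ?_⟩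
  · have := Nat.le_ceil (r / (17 * e + 1))
    rw [hm, div_le_iff₀ hK] at this
    push_cast at this
    linarith
  · rw [Finset.mem_coe, mem_prodFinset, Fintype.mem_piFinset, Finset.mem_Icc] at hy
    have h1 := h y hy.1.1 hy.1.2 fun i => Finset.mem_Icc.1 (hy.2 i)
    have h2 : (m : ℝ) < r / (17 * e + 1) := Nat.lt_ceil.1 (by omega)
    rw [lt_div_iff₀ hK] at h2
    rw [mem_ball, dist_comm]
    refine h1.trans_lt ?_
    push_cast
    linarith

lemma polynomialGrowth (e : ℕ) :
    PolynomialGrowth (Measure.count : Measure (WallLattice e)) (e + 1) := by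
  have hC : (1 : ℝ) ≤ (17 * e + 3) ^ (e + 1) :=
    one_le_pow₀ (by have : (0 : ℝ) ≤ e := by positivity
                    linarith)
  refine ⟨(17 * e + 3) ^ (e + 1), hC, fun x r hr => ⟨?_, (count_ball_le x hr).trans ?_⟩⟩
  · obtain ⟨m, n₀, h1, h2⟩ := exists_box_subset_ball x (by linarith : 0 < r)
    refine le_trans ?_ (measure_mono h2)
    rw [Measure.count_apply_finset, card_prodFinset, Fintype.card_piFinset,
      ← ENNReal.ofReal_natCast]
    refine ENNReal.ofReal_le_ofReal ?_
    have h3 : ∀ a : ℤ, (Finset.Icc a (a + m)).card = m + 1 := by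
      intro a; rw [Int.card_Icc]; omega
    simp only [h3, Finset.prod_const, Finset.card_univ, Fintype.card_fin]
    rw [← pow_succ', ← inv_pow, ← mul_pow]
    push_cast
    gcongr
    rw [inv_mul_le_iff₀ (by positivity)]
    refine h1.trans ?_
    gcongr
    norm_num
  · refine ENNReal.ofReal_le_ofReal ?_
    gcongr
    have : (0 : ℝ) ≤ e := by positivity
    linarith

/-- Horizontal lines meet no walls, so a finite set that contains a ball of radius `r` has at least
of the order of `r ^ (e + 1)` boundary points. -/
lemma ballIsoperimetry (e : ℕ) : BallIsoperimetry (graph (e + 1)) (e + 1) := by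
  classical
  refine ⟨((17 * (e + 1 : ℕ) + 1 : ℝ)⁻¹) ^ (e + 1), by positivity, fun x r hr A hA hball => ?_⟩
  obtain ⟨m, n₀, h1, h2⟩ := exists_box_subset_ball x hr
  -- `T` is a face of the cube, orthogonal to direction 0. It has (m + 1)^(e + 1) points, each the
  -- start of a line in that direction.
  set T : Finset (WallLattice (e + 1)) := prodFinset (Finset.Icc n₀ (n₀ + m))
    (Fintype.piFinset (Fin.cons {x.pos 0} fun i : Fin e =>
      Finset.Icc (x.pos i.succ) (x.pos i.succ + m))) with hT
  have hTA : ∀ y ∈ T, y ∈ A := by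
    intro y hy
    refine hball (h2 ?_)
    rw [hT, mem_prodFinset, Fintype.mem_piFinset, Fin.forall_fin_succ] at hy
    rw [Finset.mem_coe, mem_prodFinset, Fintype.mem_piFinset, Fin.forall_fin_succ]
    refine ⟨hy.1, ?_, hy.2.2⟩
    have := hy.2.1
    simp only [Fin.cons_zero, Finset.mem_singleton] at this
    simp [this]
  let shift : WallLattice (e + 1) → ℕ → WallLattice (e + 1) := fun y j =>
    ⟨y.height, Function.update y.pos 0 (y.pos 0 + j)⟩
  -- A finite set cannot contain a whole half-line, so each line leaves `A` at some point.
  have hex : ∀ y ∈ T, ∃ j : ℕ, shift y j ∈ A ∧ shift y (j + 1) ∉ A := by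
    intro y hy
    by_contra! hcon
    have hall : ∀ j, shift y j ∈ A := by
      intro j
      induction j with
      | zero => simpa [shift] using hTA y hy
      | succ j ih => exact hcon j ih
    refine (Set.infinite_of_injective_forall_mem (f := shift y) ?_ hall) hA
    intro i j hij
    have := congrArg (fun z => z.pos 0) hij
    simpa [shift] using this
  choose! j hj using hex
  refine ⟨T.image fun y => shift y (j y), ?_, ?_⟩
  · intro z hz
    obtain ⟨y, hy, rfl⟩ := Finset.mem_image.1 (Finset.mem_coe.1 hz)
    have h := hj y hy
    refine ⟨h.1, _, h.2, adj_iff.2 ⟨fun heq => h.2 (heq ▸ h.1), Or.inl (Or.inl ⟨rfl, 0, ?_⟩)⟩⟩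
    simp [shift, add_assoc]
  · rw [Finset.card_image_of_injOn]
    · rw [hT, card_prodFinset, Fintype.card_piFinset, Fin.prod_univ_succ]
      have h3 : ∀ a : ℤ, (Finset.Icc a (a + m)).card = m + 1 := by
        intro a; rw [Int.card_Icc]; omega
      simp only [Fin.cons_zero, Fin.cons_succ, h3, Finset.prod_const, Finset.card_univ,
        Fintype.card_fin, Finset.card_singleton, one_mul]
      rw [← pow_succ', ← mul_pow]
      push_cast
      gcongr
      rw [inv_mul_le_iff₀ (by positivity)]
      push_cast at h1
      exact h1
    -- The exit points are distinct because they lie on distinct parallel lines.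
    · intro y hy z hz hyz
      rw [Finset.mem_coe, hT, mem_prodFinset, Fintype.mem_piFinset, Fin.forall_fin_succ] at hy hz
      have h4 := hy.2.1
      have h5 := hz.2.1
      simp only [Fin.cons_zero, Finset.mem_singleton] at h4 h5
      have h6 : ∀ i, Function.update y.pos 0 (y.pos 0 + j y) i =
          Function.update z.pos 0 (z.pos 0 + j z) i := fun i =>
        congrFun (congrArg WallLattice.pos hyz) i
      have h7 : (shift y (j y)).height = (shift z (j z)).height := congrArg WallLattice.height hyz
      refine WallLattice.ext h7 (funext fun i => ?_)
      rcases eq_or_ne i 0 with rfl | hi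
      · rw [h4, h5]
      · have := h6 i
        rwa [Function.update_of_ne hi, Function.update_of_ne hi] at this

/-! ### Slabs between consecutive walls -/

/-- The box of height `2 ^ k` and width `4 ^ k` between the walls at heights `2 ^ k` and
`2 ^ (k + 1)`. -/
def slab (e k : ℕ) : Finset (WallLattice e) :=
  prodFinset (Finset.Ioc (2 ^ k) (2 ^ (k + 1))) (Fintype.piFinset fun _ => Finset.Ico 0 (4 ^ k))

lemma card_slab (e k : ℕ) : (slab e k).card = (2 ^ k) ^ (2 * e + 1) := by
  rw [slab, card_prodFinset, Fintype.card_piFinset, Int.card_Ioc]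
  have h1 : ((2 : ℤ) ^ (k + 1) - 2 ^ k).toNat = 2 ^ k := by
    rw [pow_succ, show (2 : ℤ) ^ k * 2 - 2 ^ k = ((2 ^ k : ℕ) : ℤ) by push_cast; ring, Int.toNat_natCast]
  have h2 : ((4 : ℤ) ^ k - 0).toNat = 4 ^ k := by
    rw [show (4 : ℤ) ^ k - 0 = ((4 ^ k : ℕ) : ℤ) by push_cast; ring, Int.toNat_natCast]
  simp only [h1, Int.card_Ico, h2, Finset.prod_const, Finset.card_univ, Fintype.card_fin]
  rw [show 4 ^ k = (2 ^ k) ^ 2 by rw [← pow_mul, mul_comm, pow_mul]; norm_num]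
  ring

lemma card_piFinset_update {ι : Type*} [Fintype ι] [DecidableEq ι] (i : ι) (s : Finset ℤ) (a : ℤ) :
    (Fintype.piFinset (Function.update (fun _ => s) i {a})).card = s.card ^ (Fintype.card ι - 1) := by
  rw [Fintype.card_piFinset]
  have : (fun j => (Function.update (fun _ : ι => s) i {a} j).card) =
      Function.update (fun _ => s.card) i 1 := by
    ext j
    rcases eq_or_ne j i with rfl | h
    · simp
    · simp [Function.update_of_ne h]
  rw [this, Finset.prod_update_of_mem (Finset.mem_univ i)]
  simp [Finset.card_sdiff]

/-- An edge leaving the slab sideways starts on one of 2(e + 1) lateral faces, each of 2^k (4^k)^e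
points. A vertical one passes through a door, and each wall contributes at most (4^k / 2^k)^(e + 1)
of these, which is no more than a face. -/
lemma exists_innerBdry_slab_subset (e k : ℕ) : ∃ S : Finset (WallLattice (e + 1)),
    innerBdry (graph (e + 1)) (slab (e + 1) k) ⊆ S ∧
      S.card ≤ (2 * (e + 1) + 2) * (2 ^ k) ^ (2 * e + 1) := by
  classical
  set H : Finset ℤ := Finset.Ioc (2 ^ k) (2 ^ (k + 1)) with hH
  set I : Finset ℤ := Finset.Ico 0 (4 ^ k) with hI
  set face : Fin (e + 1) → ℤ → Finset (WallLattice (e + 1)) := fun i a =>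
    prodFinset H (Fintype.piFinset (Function.update (fun _ => I) i {a})) with hface
  -- A wall at height n cuts the edges from n to n + 1, so the extreme heights of the slab are 2^k +
  -- 1 and 2^(k + 1). The doors of the upper wall have period 2^(k + 1) and are counted among the
  -- multiples of 2^k.
  set doors : Finset (WallLattice (e + 1)) := prodFinset {2 ^ k + 1, 2 ^ (k + 1)}
    (Fintype.piFinset fun _ => (Finset.Ico (0 : ℤ) (2 ^ k)).image fun a => 2 ^ k * a) with hdoors
  have hHc : H.card = 2 ^ k := by
    rw [hH, Int.card_Ioc, pow_succ,
      show (2 : ℤ) ^ k * 2 - 2 ^ k = ((2 ^ k : ℕ) : ℤ) by push_cast; ring, Int.toNat_natCast]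
  have hIc : I.card = 4 ^ k := by
    rw [hI, Int.card_Ico, show (4 : ℤ) ^ k - 0 = ((4 ^ k : ℕ) : ℤ) by push_cast; ring,
      Int.toNat_natCast]
  have hfc : ∀ i a, (face i a).card = (2 ^ k) ^ (2 * e + 1) := by
    intro i a
    rw [hface, card_prodFinset, card_piFinset_update, hHc, hIc, Fintype.card_fin,
      Nat.add_sub_cancel, show 4 ^ k = (2 ^ k) ^ 2 by rw [← pow_mul, mul_comm, pow_mul]; norm_num]
    ring
  have hdc : doors.card ≤ 2 * (2 ^ k) ^ (2 * e + 1) := by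
    rw [hdoors, card_prodFinset, Fintype.card_piFinset]
    refine Nat.mul_le_mul Finset.card_le_two ?_
    rw [Finset.prod_const, Finset.card_univ, Fintype.card_fin]
    calc _ ≤ (2 ^ k) ^ (e + 1) := by
          refine Nat.pow_le_pow_left (Finset.card_image_le.trans ?_) _
          rw [Int.card_Ico, show (2 : ℤ) ^ k - 0 = ((2 ^ k : ℕ) : ℤ) by push_cast; ring,
            Int.toNat_natCast]
      _ ≤ _ := Nat.pow_le_pow_right (by positivity) (by omega)
  refine ⟨(Finset.univ.biUnion fun i => face i 0 ∪ face i (4 ^ k - 1)) ∪ doors, ?_, ?_⟩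
  · rintro z ⟨hz, w, hw, hadj⟩
    have hmem : ∀ y : WallLattice (e + 1), y ∈ (slab (e + 1) k : Set (WallLattice (e + 1))) ↔
        (2 ^ k < y.height ∧ y.height ≤ 2 ^ (k + 1)) ∧ ∀ i, 0 ≤ y.pos i ∧ y.pos i < 4 ^ k := by
      intro y
      simp [slab, Fintype.mem_piFinset]
    rw [hmem] at hz hw
    have hfaces : ∀ i a, z.pos i = a → z ∈ face i a := by
      intro i a ha
      rw [hface, mem_prodFinset, hH, Finset.mem_Ioc, Fintype.mem_piFinset]
      refine ⟨hz.1, fun j => ?_⟩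
      rcases eq_or_ne j i with rfl | h
      · simp [ha]
      · rw [Function.update_of_ne h, hI, Finset.mem_Ico]
        exact hz.2 j
    have hdoor : (z.height = 2 ^ k + 1 ∨ z.height = 2 ^ (k + 1)) →
        (∀ i, (2 ^ k : ℤ) ∣ z.pos i) → z ∈ doors := by
      intro h1 h2
      rw [hdoors, mem_prodFinset, Fintype.mem_piFinset]
      refine ⟨by simpa using h1, fun i => ?_⟩
      obtain ⟨a, ha⟩ := h2 i
      have h3 := hz.2 i
      have hp : (0 : ℤ) < 2 ^ k := by positivity
      have h4 : (4 : ℤ) ^ k = 2 ^ k * 2 ^ k := by rw [← mul_pow]; norm_num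
      rw [ha, h4] at h3
      refine Finset.mem_image.2 ⟨a, Finset.mem_Ico.2 ⟨?_, ?_⟩, ha.symm⟩
      · exact nonneg_of_mul_nonneg_right h3.1 hp
      · exact lt_of_mul_lt_mul_left h3.2 hp.le
    rw [Finset.coe_union, Set.mem_union, Finset.mem_coe, Finset.mem_biUnion, Finset.mem_coe]
    simp only [Finset.mem_univ, true_and, Finset.mem_union]
    by_cases hd : z ∈ doors
    · exact Or.inr hd
    left
    by_contra! hcon
    have hin : ∀ i, 0 < z.pos i ∧ z.pos i < 4 ^ k - 1 := fun i => by
      have h1 := (hcon i).1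
      have h2 := (hcon i).2
      have h3 := hz.2 i
      have h4 : z.pos i ≠ 0 := fun h => h1 (hfaces i _ h)
      have h5 : z.pos i ≠ 4 ^ k - 1 := fun h => h2 (hfaces i _ h)
      omega
    apply hw
    rcases (adj_iff.1 hadj).2 with (⟨h1, i, h2⟩ | ⟨h1, h2, h3⟩) | (⟨h1, i, h2⟩ | ⟨h1, h2, h3⟩)
    · refine ⟨h1 ▸ hz.1, fun l => ?_⟩
      have := hin l
      have := congrFun h2 l
      rcases eq_or_ne l i with rfl | h
      · rw [Function.update_self] at this; omega
      · rw [Function.update_of_ne h] at this; omega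
    · refine ⟨?_, fun l => h2 ▸ hz.2 l⟩
      by_cases h4 : z.height = 2 ^ (k + 1)
      · exact absurd (hdoor (Or.inr h4) fun i =>
          (pow_dvd_pow 2 (Nat.le_succ k)).trans (h3 (k + 1) h4 i)) hd
      · omega
    · refine ⟨h1 ▸ hz.1, fun l => ?_⟩
      have := hin l
      have := congrFun h2 l
      rcases eq_or_ne l i with rfl | h
      · rw [Function.update_self] at this; omega
      · rw [Function.update_of_ne h] at this; omega
    · refine ⟨?_, fun l => h2 ▸ hz.2 l⟩
      by_cases h4 : w.height = 2 ^ k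
      · exact absurd (hdoor (Or.inl (by omega)) fun i => h2 ▸ h3 k h4 i) hd
      · omega
  · refine (Finset.card_union_le _ _).trans ?_
    have : (Finset.univ.biUnion fun i => face i 0 ∪ face i (4 ^ k - 1)).card ≤
        (e + 1) * (2 * (2 ^ k) ^ (2 * e + 1)) := by
      refine Finset.card_biUnion_le.trans ((Finset.sum_le_card_nsmul _ _
        (2 * (2 ^ k) ^ (2 * e + 1)) fun i _ => ?_).trans (by simp))
      refine (Finset.card_union_le _ _).trans ?_
      rw [hfc, hfc, ← two_mul]
    linarith

end WallLattice

/-! ### Boundaries in metric spaces, graph paths and counting in balls -/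

section Boundary

variable {X : Type u} [MetricSpace X]

lemma exists_dist_lt_of_mem_cthickening {h h' : ℝ} (h0 : 0 < h') (hh : h < h') {A : Set X} {x : X}
    (hx : x ∈ cthickening h A) : ∃ a ∈ A, dist x a < h' :=
  mem_thickening_iff.1 (cthickening_subset_thickening' h0 hh A hx)

lemma measurableSet_bdry [MeasurableSpace X] [BorelSpace X] (h : ℝ) (A : Set X) :
    MeasurableSet (bdry h A) :=
  (isClosed_cthickening.inter isClosed_cthickening).measurableSet

lemma mem_bdry_of_dist_le {h : ℝ} {A : Set X} {x a b : X} (ha : a ∈ A) (hb : b ∉ A)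
    (hxa : dist x a ≤ h) (hxb : dist x b ≤ h) : x ∈ bdry h A :=
  ⟨mem_cthickening_of_dist_le _ _ _ _ ha hxa, mem_cthickening_of_dist_le _ _ _ _ hb hxb⟩

lemma abs_dist_sub_lt_of_mem_bdry_ball {h h' s : ℝ} (h0 : 0 < h') (hh : h < h') {x y : X}
    (hy : y ∈ bdry h (ball x s)) : s - h' < dist y x ∧ dist y x < s + h' := by
  obtain ⟨a, ha, hya⟩ := exists_dist_lt_of_mem_cthickening h0 hh hy.1
  obtain ⟨b, hb, hyb⟩ := exists_dist_lt_of_mem_cthickening h0 hh hy.2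
  rw [mem_compl_iff, mem_ball, not_lt] at hb
  rw [mem_ball] at ha
  have h1 := dist_triangle y a x
  have h2 := dist_triangle b y x
  rw [dist_comm b y] at h2
  constructor <;> linarith

lemma exists_crossing {α : Type*} {A : Set α} {c : ℕ → α} {n : ℕ} (h0 : c 0 ∈ A) (hn : c n ∉ A) :
    ∃ i < n, c i ∈ A ∧ c (i + 1) ∉ A := by
  by_contra! hcon
  have : ∀ i ≤ n, c i ∈ A := by
    intro i
    induction i with
    | zero => exact fun _ => h0
    | succ i ih => exact fun hi => hcon i hi (ih (by omega))
  exact hn (this n le_rfl)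

end Boundary

section Graph

variable {X : Type u} [MetricSpace X] {G : SimpleGraph X}

lemma IsGraphMetric.dist_eq_one (hG : IsGraphMetric G) {x y : X} (h : G.Adj x y) :
    dist x y = 1 := by
  rw [hG.2, SimpleGraph.dist_eq_one_iff_adj.2 h, Nat.cast_one]

lemma IsGraphMetric.exists_chain (hG : IsGraphMetric G) (x y : X) :
    ∃ (n : ℕ) (c : ℕ → X), c 0 = x ∧ c n = y ∧ (∀ i < n, G.Adj (c i) (c (i + 1))) ∧
      (n : ℝ) = dist x y ∧ ∀ i ≤ n, dist x (c i) ≤ i := by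
  obtain ⟨p, hp⟩ := hG.1.exists_walk_length_eq_dist x y
  refine ⟨p.length, p.getVert, p.getVert_zero, p.getVert_length,
    fun i hi => p.adj_getVert_succ hi, by rw [hp, hG.2], fun i => ?_⟩
  induction i with
  | zero => simp
  | succ i ih =>
    intro hi
    have h1 := ih (by omega)
    have h2 := hG.dist_eq_one (p.adj_getVert_succ (i := i) (by omega))
    have h3 := dist_triangle x (p.getVert i) (p.getVert (i + 1))
    push_cast
    linarith

lemma IsGraphMetric.exists_mem_innerBdry (hG : IsGraphMetric G) {A : Set X} {x y : X}
    (hx : x ∈ A) (hy : y ∉ A) : ∃ z ∈ innerBdry G A, dist x z ≤ dist x y := by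
  obtain ⟨n, c, rfl, rfl, hadj, hn, hdist⟩ := hG.exists_chain x y
  obtain ⟨i, hi, h1, h2⟩ := exists_crossing hx hy
  refine ⟨c i, ⟨h1, _, h2, hadj i hi⟩, (hdist i hi.le).trans ?_⟩
  rw [← hn]
  exact_mod_cast hi.le

lemma IsGraphMetric.innerBdry_subset_bdry (hG : IsGraphMetric G) {h : ℝ} (hh : 1 ≤ h) (A : Set X) :
    innerBdry G A ⊆ bdry h A := by
  rintro z ⟨hz, w, hw, hadj⟩
  refine mem_bdry_of_dist_le hz hw ?_ ?_
  · rw [dist_self]; linarith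
  · rwa [hG.dist_eq_one hadj]

end Graph

section Growth

variable {X : Type u} [MetricSpace X] [MeasurableSpace X] [BorelSpace X]

lemma PolynomialGrowth.exists_card_le {d : ℕ}
    (h : PolynomialGrowth (Measure.count : Measure X) d) :
    ∃ C : ℝ, 1 ≤ C ∧ ∀ (x : X) (r : ℝ), 1 ≤ r → ∀ S : Finset X, ↑S ⊆ ball x r →
      (S.card : ℝ) ≤ C * r ^ d := by
  obtain ⟨C, hC, h⟩ := h
  refine ⟨C, hC, fun x r hr S hS => ?_⟩
  have := (measure_mono hS).trans (h x r hr).2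
  rw [Measure.count_apply_finset, ← ENNReal.ofReal_natCast] at this
  exact (ENNReal.ofReal_le_ofReal_iff (by positivity)).1 this

lemma PolynomialGrowth.finite_ball {d : ℕ}
    (h : PolynomialGrowth (Measure.count : Measure X) d) (x : X) (r : ℝ) : (ball x r).Finite := by
  obtain ⟨C, hC, h⟩ := h
  rw [← Measure.count_apply_lt_top]
  exact ((measure_mono (ball_subset_ball (le_max_left r 1))).trans
    (h x _ (le_max_right r 1)).2).trans_lt ENNReal.ofReal_lt_top

lemma PolynomialGrowth.exists_card_le_nat {d : ℕ}
    (h : PolynomialGrowth (Measure.count : Measure X) d) (R : ℝ) :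
    ∃ N : ℕ, ∀ (x : X) (S : Finset X), ↑S ⊆ ball x R → S.card ≤ N := by
  obtain ⟨C, hC, h⟩ := h.exists_card_le
  refine ⟨⌊C * max R 1 ^ d⌋₊, fun x S hS => Nat.le_floor ?_⟩
  exact h x _ (le_max_right R 1) S (hS.trans (ball_subset_ball (le_max_left R 1)))

end Growth

/-! ### Coarse charts: measures and boundaries under large-scale equivalence -/

lemma DVloc.exists_scale {Y : Type v} [MetricSpace Y] [MeasurableSpace Y] {ν : Measure Y}
    (h : DVloc ν) {r : ℝ} (hr : 0 < r) (R : ℝ) :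
    ∃ C : ℝ≥0, ∀ y, ν (ball y R) ≤ C * ν (ball y r) := by
  have key : ∀ k : ℕ, ∃ C : ℝ≥0, ∀ y, ν (ball y (2 ^ k * r)) ≤ C * ν (ball y r) := by
    intro k
    induction k with
    | zero => exact ⟨1, fun y => by simp⟩
    | succ k ih =>
      obtain ⟨C, hC⟩ := ih
      obtain ⟨C', hC'⟩ := h (2 ^ k * r) (by positivity)
      refine ⟨C' * C, fun y => ?_⟩
      rw [pow_succ', mul_assoc, ENNReal.coe_mul, mul_assoc]
      exact (hC' y).trans (by gcongr; exact hC y)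
  obtain ⟨k, hk⟩ := pow_unbounded_of_one_lt (R / r) (one_lt_two : (1 : ℝ) < 2)
  obtain ⟨C, hC⟩ := key k
  rw [div_lt_iff₀ hr] at hk
  exact ⟨C, fun y => (measure_mono (ball_subset_ball hk.le)).trans (hC y)⟩

/-- A quasi-isometry from a graph to a metric measure space that is doubling at fixed radius and
in which the unit balls centered on the image have measure about `1`. -/
structure CoarseChart {X : Type u} {Y : Type v} [MetricSpace X] [MetricSpace Y] [MeasurableSpace Y]
    (ν : Measure Y) (f : X → Y) (D : ℝ≥0) : Prop where
  one_le : (1 : ℝ) ≤ D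
  exists_near : ∀ y, ∃ x, dist y (f x) < D
  dist_le : ∀ x x', dist (f x) (f x') ≤ D * dist x x' + D
  le_dist : ∀ x x', dist x x' ≤ D * (dist (f x) (f x') + D)
  dvloc : DVloc ν
  measure_ball_le : ∀ x, ν (ball (f x) 1) ≤ D
  one_le_measure_ball : ∀ x, 1 ≤ D * ν (ball (f x) 1)

lemma LargeScaleEquivalent.exists_coarseChart {X : Type u} {Y : Type v} [MetricSpace X]
    [MeasurableSpace X] [BorelSpace X] [MetricSpace Y] [MeasurableSpace Y] {G : SimpleGraph X}
    (hG : IsGraphMetric G) {ν : Measure Y}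
    (h : LargeScaleEquivalent (Measure.count : Measure X) ν) :
    ∃ (f : X → Y) (D : ℝ≥0), CoarseChart ν f D := by
  obtain ⟨-, hν, f, C₁, C₂, C₃, h1, h2, h3, ⟨hsurj, hq⟩, hm⟩ := h
  have hone : ∀ x : X, (Measure.count : Measure X) (ball x 1) = 1 := fun x => by
    rw [hG.ball_one, Measure.count_singleton]
  simp only [hone, mul_one] at hm
  -- The extra 1 turns the closed thickening into the strict inequality of `exists_near`.
  refine ⟨f, max (C₁ + 1).toNNReal (max C₂.toNNReal C₃), ?_⟩
  set D := max (C₁ + 1).toNNReal (max C₂.toNNReal C₃) with hD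
  have hD1 : C₁ + 1 ≤ D := (Real.le_coe_toNNReal _).trans (by exact_mod_cast le_max_left _ _)
  have hD2 : C₂ ≤ D := (Real.le_coe_toNNReal _).trans
    (by exact_mod_cast (le_max_left _ _).trans (le_max_right _ _))
  have hD3 : C₃ ≤ D := (le_max_right _ _).trans (le_max_right _ _)
  refine ⟨h2.trans hD2, fun y => ?_, fun x x' => ?_, fun x x' => ?_, hν, fun x => ?_, fun x => ?_⟩
  · have hy : y ∈ cthickening C₁ (range f) := hsurj ▸ mem_univ y
    obtain ⟨_, ⟨x, rfl⟩, hx⟩ := exists_dist_lt_of_mem_cthickening (h' := C₁ + 1) (by linarith)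
      (by linarith) hy
    exact ⟨x, hx.trans_le hD1⟩
  · exact (hq x x').2.trans (by gcongr)
  · have h4 := (hq x x').1
    have h5 : dist x x' ≤ C₂ * (dist (f x) (f x') + C₂) := by
      rw [← inv_mul_le_iff₀ (by linarith)]; linarith
    exact h5.trans (by gcongr)
  · exact (hm x).2.trans (by exact_mod_cast hD3)
  · have h4 := (hm x).1
    have h5 : (C₃ : ℝ≥0∞) ≠ 0 := by
      rw [Ne, ENNReal.coe_eq_zero]; rintro rfl; exact absurd h3 (by simp)
    calc (1 : ℝ≥0∞) = C₃ * (C₃ : ℝ≥0∞)⁻¹ := (ENNReal.mul_inv_cancel h5 ENNReal.coe_ne_top).symm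
      _ ≤ D * ν (ball (f x) 1) := by gcongr

namespace CoarseChart

variable {X : Type u} {Y : Type v} [MetricSpace X] [MetricSpace Y] [MeasurableSpace Y]
  {ν : Measure Y} {f : X → Y} {D : ℝ≥0} {d : ℕ} {G : SimpleGraph X}

/-- Each ball lies in a ball of fixed radius centered on the image, which doubling compares with the
unit ball there. -/
lemma exists_measure_ball_le (H : CoarseChart ν f D) (R : ℝ) :
    ∃ M : ℝ≥0, ∀ y, ν (ball y R) ≤ M := by
  obtain ⟨C, hC⟩ := H.dvloc.exists_scale one_pos (R + D)
  refine ⟨C * D, fun y => ?_⟩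
  obtain ⟨x, hx⟩ := H.exists_near y
  calc ν (ball y R) ≤ ν (ball (f x) (R + D)) := measure_mono (ball_subset_ball' (by linarith))
    _ ≤ C * ν (ball (f x) 1) := hC _
    _ ≤ _ := by rw [ENNReal.coe_mul]; gcongr; exact H.measure_ball_le x

lemma exists_one_le_measure_ball (H : CoarseChart ν f D) {r : ℝ} (hr : 0 < r) :
    ∃ m : ℝ≥0, ∀ y, 1 ≤ m * ν (ball y r) := by
  obtain ⟨C, hC⟩ := H.dvloc.exists_scale hr (1 + D)
  refine ⟨D * C, fun y => ?_⟩
  obtain ⟨x, hx⟩ := H.exists_near y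
  rw [dist_comm] at hx
  calc 1 ≤ D * ν (ball (f x) 1) := H.one_le_measure_ball x
    _ ≤ D * ν (ball y (1 + D)) := by
      gcongr; exact ball_subset_ball' (by linarith)
    _ ≤ D * (C * ν (ball y r)) := by gcongr; exact hC y
    _ = _ := by rw [ENNReal.coe_mul, mul_assoc]

/-- Covering bound: measure in the target is at most a multiple of a count in the graph.
`exists_card_le_measure` is the converse. -/
lemma exists_measure_le_card (H : CoarseChart ν f D) (R : ℝ) :
    ∃ M : ℝ≥0, ∀ (S : Finset X) (U : Set Y), (∀ y ∈ U, ∃ z ∈ S, dist y (f z) < R) →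
      ν U ≤ M * S.card := by
  obtain ⟨M, hM⟩ := H.exists_measure_ball_le R
  refine ⟨M, fun S U h => ?_⟩
  calc ν U ≤ ν (⋃ z ∈ S, ball (f z) R) := measure_mono fun y hy => by
        obtain ⟨z, hz, hyz⟩ := h y hy
        exact mem_iUnion₂.2 ⟨z, hz, hyz⟩
    _ ≤ ∑ z ∈ S, ν (ball (f z) R) := measure_biUnion_finset_le _ _
    _ ≤ ∑ z ∈ S, (M : ℝ≥0∞) := Finset.sum_le_sum fun z _ => hM _
    _ = _ := by rw [Finset.sum_const, nsmul_eq_mul, mul_comm]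

/-- A graph path between points of the graph maps to a 2D-chain, since an edge has image of length
at most 2D. Adding the two given points as ends keeps the steps below 2D. -/
lemma exists_admissibleScale (H : CoarseChart ν f D) (hG : IsGraphMetric G) :
    ∃ h, AdmissibleScale Y h := by
  have hD := H.one_le
  refine ⟨2 * (2 * D), 2 * D, by positivity, fun E₁ hE₁ => ?_, le_rfl⟩
  refine ⟨E₁ + 2 * D + D * (D * (E₁ + 3 * D)) + 1, by
    have : (0 : ℝ) ≤ D * (D * (E₁ + 3 * D)) := by positivity
    linarith, fun x y hxy => ?_⟩
  have hpos : (0 : ℝ) ≤ D * (D * (E₁ + 3 * D)) := by positivity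
  obtain ⟨z, hz⟩ := H.exists_near x
  obtain ⟨w, hw⟩ := H.exists_near y
  obtain ⟨n, c, hc0, hcn, hadj, hn, hdist⟩ := hG.exists_chain z w
  have hzw : dist z w ≤ D * (E₁ + 3 * D) := by
    refine (H.le_dist z w).trans ?_
    have := dist_triangle4 (f z) x y (f w)
    rw [dist_comm (f z) x] at this
    exact mul_le_mul_of_nonneg_left (by linarith) D.coe_nonneg
  refine ⟨n + 2, fun i => if i = 0 then x else if i ≤ n + 1 then f (c (i - 1)) else y,
    by simp, by simp, fun i hi => ?_, fun i hi => ?_⟩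
  · rcases i with _ | i
    · simp only [hc0, if_true, zero_add, one_ne_zero, if_false, Nat.le_add_left, Nat.sub_self]
      linarith
    · rcases Nat.lt_or_ge i n with hin | hin
      · have h1 : i + 1 ≤ n + 1 := by omega
        have h2 : i + 1 + 1 ≤ n + 1 := by omega
        simp only [Nat.add_eq_zero_iff, one_ne_zero, and_false, if_false, h1, h2, if_true,
          Nat.add_sub_cancel]
        have := H.dist_le (c i) (c (i + 1))
        rw [hG.dist_eq_one (hadj i hin)] at this
        linarith
      · obtain rfl : i = n := by omega
        simp only [Nat.add_eq_zero_iff, one_ne_zero, and_false, if_false, le_refl, if_true,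
          Nat.add_sub_cancel, hcn]
        rw [if_neg (by omega), dist_comm]
        linarith
  · dsimp only
    split_ifs with h1 h2
    · simp only [mem_ball, dist_self]; linarith
    · have h3 := hdist (i - 1) (by omega)
      have h4 : ((i - 1 : ℕ) : ℝ) ≤ n := by exact_mod_cast (by omega)
      have h5 := H.dist_le z (c (i - 1))
      have h6 : (D : ℝ) * dist z (c (i - 1)) ≤ D * (D * (E₁ + 3 * D)) := by
        gcongr; linarith
      rw [mem_ball, dist_comm]
      linarith [dist_triangle x (f z) (f (c (i - 1)))]
    · rw [mem_ball, dist_comm]; linarith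

variable [MeasurableSpace X] [BorelSpace X]

lemma finite_preimage_ball (H : CoarseChart ν f D)
    (hX : PolynomialGrowth (Measure.count : Measure X) d) (y : Y) (r : ℝ) :
    (f ⁻¹' ball y r).Finite := by
  obtain ⟨x, hx⟩ := H.exists_near y
  refine (hX.finite_ball x (D * (r + D + D) + 1)).subset fun z hz => ?_
  rw [mem_preimage, mem_ball] at hz
  have h1 := H.le_dist z x
  have h2 := dist_triangle (f z) y (f x)
  rw [mem_ball]
  have : (D : ℝ) * (dist (f z) (f x) + D) ≤ D * (r + D + D) := by
    gcongr; linarith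
  linarith

lemma exists_measure_ball_le_pow (H : CoarseChart ν f D)
    (hX : PolynomialGrowth (Measure.count : Measure X) d) :
    ∃ C : ℝ, 1 ≤ C ∧ ∀ (y : Y) (r : ℝ), 1 ≤ r → ν (ball y r) ≤ ENNReal.ofReal (C * r ^ d) := by
  obtain ⟨M, hM⟩ := H.exists_measure_le_card D
  obtain ⟨K, hK1, hK⟩ := hX.exists_card_le
  have hD := H.one_le
  refine ⟨(M + 1) * (K * (5 * D ^ 2) ^ d), ?_, fun y r hr => ?_⟩
  · have h1 : (1 : ℝ) ≤ (5 * D ^ 2) ^ d := one_le_pow₀ (by nlinarith)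
    have h2 : (1 : ℝ) ≤ M + 1 := by linarith [M.coe_nonneg]
    have h3 : (1 : ℝ) ≤ K * (5 * D ^ 2) ^ d := one_le_mul_of_one_le_of_one_le hK1 h1
    exact one_le_mul_of_one_le_of_one_le h2 h3
  obtain ⟨x, hx⟩ := H.exists_near y
  -- Points whose images are within D of `ball y r` lie within D(r + 3D) ≤ 4D²r of x, strictly
  -- inside the ball of radius 5D²r.
  set S := (hX.finite_ball x (5 * D ^ 2 * r)).toFinset with hS
  have h1 : ν (ball y r) ≤ M * S.card := by
    refine hM S _ fun p hp => ?_
    obtain ⟨z, hz⟩ := H.exists_near p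
    refine ⟨z, ?_, hz⟩
    rw [hS, Finite.mem_toFinset, mem_ball]
    rw [mem_ball] at hp
    have h2 := H.le_dist z x
    have h3 := dist_triangle4 (f z) p y (f x)
    rw [dist_comm (f z) p] at h3
    have h4 : (D : ℝ) * (dist (f z) (f x) + D) ≤ D * (r + 3 * D) :=
      mul_le_mul_of_nonneg_left (by linarith) D.coe_nonneg
    nlinarith [mul_le_mul_of_nonneg_left hD (by positivity : (0 : ℝ) ≤ D * r),
      mul_le_mul_of_nonneg_left hr (by positivity : (0 : ℝ) ≤ D ^ 2)]
  have h2 : (S.card : ℝ) ≤ K * (5 * D ^ 2 * r) ^ d :=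
    hK x _ (by nlinarith) S (by simp [hS])
  refine h1.trans ?_
  rw [← ENNReal.ofReal_coe_nnreal, ← ENNReal.ofReal_natCast, ← ENNReal.ofReal_mul (by positivity)]
  refine ENNReal.ofReal_le_ofReal ?_
  calc (M : ℝ) * S.card ≤ (M + 1) * (K * (5 * D ^ 2 * r) ^ d) := by
        gcongr; linarith
    _ = _ := by rw [mul_pow (5 * (D : ℝ) ^ 2) r]; ring

variable [BorelSpace Y]

/-- Balls centered near the images of the points of `S` overlap boundedly often. -/
lemma exists_card_le_measure (H : CoarseChart ν f D)
    (hX : PolynomialGrowth (Measure.count : Measure X) d) (E : ℝ) {ρ : ℝ} (hρ : 0 < ρ) :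
    ∃ K : ℝ≥0, 1 ≤ K ∧ ∀ (S : Finset X) (c : X → Y) (U : Set Y), (∀ z ∈ S, dist (c z) (f z) ≤ E) →
      (∀ z ∈ S, ball (c z) ρ ⊆ U) → (S.card : ℝ≥0∞) ≤ K * ν U := by
  classical
  obtain ⟨m, hm⟩ := H.exists_one_le_measure_ball hρ
  obtain ⟨N, hN⟩ := hX.exists_card_le_nat (D * (2 * (E + ρ) + D) + 1)
  refine ⟨m * N + 1, by simp, fun S c U hc hU => ?_⟩
  -- All z whose ball contains a given p lie in one ball of fixed radius in the graph, hence there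
  -- are at most `N` of them.
  have hmult : ∀ p, ∑ z ∈ S, (ball (c z) ρ).indicator (1 : Y → ℝ≥0∞) p ≤
      (⋃ z ∈ S, ball (c z) ρ).indicator (fun _ => (N : ℝ≥0∞)) p := by
    intro p
    have hsum : ∑ z ∈ S, (ball (c z) ρ).indicator (1 : Y → ℝ≥0∞) p =
        (S.filter fun z => p ∈ ball (c z) ρ).card := by
      rw [Finset.card_filter]
      push_cast
      rfl
    rw [hsum]
    rcases (S.filter fun z => p ∈ ball (c z) ρ).eq_empty_or_nonempty with h | ⟨z₀, hz₀⟩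
    · rw [h]; simp
    · have hz₀' := Finset.mem_filter.1 hz₀
      rw [indicator_of_mem (mem_iUnion₂.2 ⟨z₀, hz₀'.1, hz₀'.2⟩)]
      refine Nat.cast_le.2 (hN z₀ _ fun z hz => ?_)
      have hz' := Finset.mem_filter.1 (Finset.mem_coe.1 hz)
      have h1 := mem_ball.1 hz'.2
      have h2 := mem_ball.1 hz₀'.2
      have h3 := hc z hz'.1
      have h4 := hc z₀ hz₀'.1
      have h5 := dist_triangle4 (f z) (c z) p (f z₀)
      have h6 := dist_triangle p (c z₀) (f z₀)
      rw [dist_comm (f z) (c z), dist_comm (c z) p] at h5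
      have h7 := H.le_dist z z₀
      rw [mem_ball]
      have : (D : ℝ) * (dist (f z) (f z₀) + D) ≤ D * (2 * (E + ρ) + D) := by
        gcongr; linarith
      linarith
  have hopen : IsOpen (⋃ z ∈ S, ball (c z) ρ) := isOpen_biUnion fun _ _ => isOpen_ball
  calc (S.card : ℝ≥0∞) = ∑ z ∈ S, (1 : ℝ≥0∞) := by simp
    _ ≤ ∑ z ∈ S, m * ν (ball (c z) ρ) := Finset.sum_le_sum fun z _ => hm _
    _ = m * ∫⁻ p, ∑ z ∈ S, (ball (c z) ρ).indicator (1 : Y → ℝ≥0∞) p ∂ν := by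
      rw [lintegral_finsetSum _ fun z _ => measurable_one.indicator measurableSet_ball,
        ← Finset.mul_sum]
      simp_rw [lintegral_indicator_one measurableSet_ball]
    _ ≤ m * ∫⁻ p, (⋃ z ∈ S, ball (c z) ρ).indicator (fun _ => (N : ℝ≥0∞)) p ∂ν := by
      gcongr with p; exact hmult p
    _ = m * (N * ν (⋃ z ∈ S, ball (c z) ρ)) := by
      rw [lintegral_indicator_const hopen.measurableSet]
    _ ≤ m * (N * ν U) := by gcongr; exact iUnion₂_subset hU
    _ = (m * N : ℝ≥0∞) * ν U := by rw [mul_assoc]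
    _ ≤ _ := by
      gcongr
      push_cast
      exact le_self_add

/-- The boundary of `B` at an admissible scale has measure at least of the order of the number of
points whose images are close to both `B` and its complement. -/
lemma exists_card_le_measure_bdry (H : CoarseChart ν f D)
    (hX : PolynomialGrowth (Measure.count : Measure X) d) {h : ℝ} (hh : AdmissibleScale Y h)
    {E : ℝ} (hE : 0 < E) :
    ∃ K : ℝ≥0, 1 ≤ K ∧ ∀ (S : Finset X) (B : Set Y),
      (∀ z ∈ S, (∃ p ∈ B, dist p (f z) ≤ E) ∧ ∃ q, q ∉ B ∧ dist q (f z) ≤ E) →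
        (S.card : ℝ≥0∞) ≤ K * ν (bdry h B) := by
  obtain ⟨b, hb, hconn, hbh⟩ := hh
  obtain ⟨E₂, -, hchain⟩ := hconn (2 * E) (by linarith)
  obtain ⟨K, hK1, hK⟩ := H.exists_card_le_measure hX (E₂ + E) hb
  refine ⟨K, hK1, fun S B hS => ?_⟩
  -- A b-chain from p to q has a step out of `B`. The b-ball about the start of that step is within
  -- 2b ≤ h of both ends, so it lies in the boundary.
  have hc : ∀ z ∈ S, ∃ y, dist y (f z) ≤ E₂ + E ∧ ball y b ⊆ bdry h B := by
    intro z hz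
    obtain ⟨⟨p, hp, hpz⟩, q, hq, hqz⟩ := hS z hz
    obtain ⟨n, c, hc0, hcn, hstep, hball⟩ := hchain p q (by
      linarith [dist_triangle_right p q (f z)])
    obtain ⟨i, hi, hi1, hi2⟩ := exists_crossing (A := B) (c := c) (n := n) (hc0 ▸ hp) (hcn ▸ hq)
    refine ⟨c i, ?_, fun x hx => ?_⟩
    · have := mem_ball.1 (hball i hi.le)
      linarith [dist_triangle (c i) p (f z)]
    · rw [mem_ball] at hx
      have := hstep i hi
      exact mem_bdry_of_dist_le hi1 hi2 (by linarith)
        (by linarith [dist_triangle x (c i) (c (i + 1))])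
  rcases S.eq_empty_or_nonempty with rfl | ⟨z₀, -⟩
  · simp
  have : Nonempty Y := ⟨f z₀⟩
  choose! c hc1 hc2 using hc
  exact hK S c _ hc1 hc2

variable {k : ℕ}

/-- The preimage of a ball is a finite set containing a graph ball of comparable radius, so
`BallIsoperimetry` supplies many points mapped close to the sphere. -/
lemma exists_le_measure_bdry_ball (H : CoarseChart ν f D)
    (hX : PolynomialGrowth (Measure.count : Measure X) d) (hG : IsGraphMetric G)
    (hiso : BallIsoperimetry G k) {h : ℝ} (hh : AdmissibleScale Y h) :
    ∃ c : ℝ, 0 < c ∧ ∀ (y : Y) (r : ℝ), 1 ≤ r →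
      ENNReal.ofReal (c * r ^ k) ≤ ν (bdry h (ball y r)) := by
  have hD := H.one_le
  obtain ⟨c, hc, hiso⟩ := hiso
  obtain ⟨K, hK1, hK⟩ := H.exists_card_le_measure_bdry hX hh (by positivity : (0 : ℝ) < 6 * D)
  have hK0 : (0 : ℝ) < K := by exact_mod_cast zero_lt_one.trans_le hK1
  refine ⟨c / (4 * D) ^ k / K, by positivity, fun y r hr => ?_⟩
  have key : ∃ S : Finset X, c / (4 * D) ^ k * r ^ k ≤ S.card ∧ ∀ z ∈ S,
      (∃ p ∈ ball y r, dist p (f z) ≤ 6 * D) ∧ ∃ q, q ∉ ball y r ∧ dist q (f z) ≤ 6 * D := by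
    obtain ⟨x, hx⟩ := H.exists_near y
    rw [dist_comm] at hx
    have hstep : ∀ z w, G.Adj z w → dist (f w) (f z) ≤ 2 * D := fun z w hzw => by
      have := H.dist_le w z
      rw [hG.dist_eq_one hzw.symm] at this
      linarith
    rcases lt_or_ge r (4 * D) with hr4 | hr4
    -- For r < 4D the ball may miss the image altogether, so the preimage of the larger ball of
    -- radius 6D is used. Its inner boundary maps to within 6D of y, and the exits `f w` lie outside
    -- the smaller ball too.
    · obtain ⟨S, hS, hcard⟩ := hiso x 1 one_pos (f ⁻¹' ball y (6 * D))
        (H.finite_preimage_ball hX _ _) (by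
          rw [hG.ball_one, singleton_subset_iff, mem_preimage, mem_ball]
          linarith)
      refine ⟨S, le_trans ?_ hcard, fun z hz => ?_⟩
      · rw [one_pow, mul_one, div_mul_eq_mul_div, mul_div_assoc, ← div_pow]
        refine mul_le_of_le_one_right hc.le (pow_le_one₀ (by positivity) ?_)
        rw [div_le_one (by positivity)]
        exact hr4.le
      · obtain ⟨h1, w, h2, hadj⟩ := hS hz
        rw [mem_preimage, mem_ball] at h1 h2
        refine ⟨⟨y, mem_ball_self (by linarith), by rw [dist_comm]; exact h1.le⟩, f w, ?_, ?_⟩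
        · rw [mem_ball]; linarith
        · linarith [hstep z w hadj]
    · obtain ⟨S, hS, hcard⟩ := hiso x (r / (2 * D)) (by positivity) (f ⁻¹' ball y r)
        (H.finite_preimage_ball hX _ _) (fun z hz => by
          rw [mem_ball, lt_div_iff₀ (by positivity)] at hz
          rw [mem_preimage, mem_ball]
          have := H.dist_le z x
          linarith [dist_triangle (f z) (f x) y])
      refine ⟨S, le_trans ?_ hcard, fun z hz => ?_⟩
      · rw [div_mul_eq_mul_div, mul_div_assoc, ← div_pow]
        gcongr
        norm_num
      · obtain ⟨h1, w, h2, hadj⟩ := hS hz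
        exact ⟨⟨f z, h1, by rw [dist_self]; positivity⟩, f w, h2,
          by linarith [hstep z w hadj]⟩
  obtain ⟨S, hS1, hS2⟩ := key
  have h1 := hK S (ball y r) hS2
  calc ENNReal.ofReal (c / (4 * D) ^ k / K * r ^ k)
      = ENNReal.ofReal (c / (4 * D) ^ k * r ^ k) / K := by
        rw [div_mul_eq_mul_div, ENNReal.ofReal_div_of_pos hK0, ENNReal.ofReal_coe_nnreal]
    _ ≤ S.card / K := by
        gcongr
        rw [← ENNReal.ofReal_natCast]
        exact ENNReal.ofReal_le_ofReal hS1
    _ ≤ ν (bdry h (ball y r)) := ENNReal.div_le_of_le_mul' h1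

/-- Pigeonhole: about r/(3h) disjoint spheres with radii in [r, 2r] share a volume O(r^(k+1)), so
the smallest has volume O(r^k). -/
lemma exists_measure_bdry_ball_le (H : CoarseChart ν f D)
    (hX : PolynomialGrowth (Measure.count : Measure X) (k + 1)) {h : ℝ} (hh : 0 < h) :
    ∃ C : ℝ, 1 ≤ C ∧ ∀ (y : Y) (r : ℝ), 1 ≤ r →
      ∃ s ∈ Icc r (2 * r), ν (bdry h (ball y s)) ≤ ENNReal.ofReal (C * r ^ k) := by
  obtain ⟨C, hC, hball⟩ := H.exists_measure_ball_le_pow hX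
  refine ⟨max 1 (C * (2 + 2 * h) ^ (k + 1) * (3 * h)), le_max_left _ _, fun y r hr => ?_⟩
  set N := ⌊r / (3 * h)⌋₊ + 1 with hN
  have hNr : r / (3 * h) ≤ N := by
    rw [hN]; push_cast; exact (Nat.lt_floor_add_one _).le
  set B : ℕ → Set Y := fun i => bdry h (ball y (r + 3 * h * i)) with hB
  -- Any half-width strictly between h and 3h/2 would do: it exceeds h, and the spacing 3h keeps the
  -- annuli disjoint.
  have hann : ∀ i p, p ∈ B i →
      r + 3 * h * i - 5 / 4 * h < dist p y ∧ dist p y < r + 3 * h * i + 5 / 4 * h := fun i p hp =>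
    abs_dist_sub_lt_of_mem_bdry_ball (by linarith) (by linarith) hp
  have hle : ∀ i ∈ Finset.range N, 3 * h * (i : ℝ) ≤ r := by
    intro i hi
    have h1 : (i : ℝ) ≤ r / (3 * h) :=
      (Nat.le_floor_iff (by positivity)).1 (by rw [Finset.mem_range] at hi; omega)
    rw [le_div_iff₀ (by positivity)] at h1
    linarith
  have hdisj : (Finset.range N : Set ℕ).PairwiseDisjoint B := by
    have key : ∀ i j : ℕ, i < j → Disjoint (B i) (B j) := by
      intro i j hij
      refine Set.disjoint_left.2 fun p hp hq => ?_
      have h1 := (hann i p hp).2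
      have h2 := (hann j p hq).1
      have h3 : (i : ℝ) + 1 ≤ j := by exact_mod_cast hij
      nlinarith
    intro i _ j _ hij
    rcases lt_or_gt_of_ne hij with h1 | h1
    · exact key i j h1
    · exact (key j i h1).symm
  have hsum : ∑ i ∈ Finset.range N, ν (B i) ≤
      ENNReal.ofReal (C * (2 + 2 * h) ^ (k + 1) * r ^ (k + 1)) := by
    rw [← measure_biUnion_finset hdisj fun i _ => measurableSet_bdry _ _]
    refine (measure_mono (iUnion₂_subset fun i hi p hp => ?_)).trans
      ((hball y ((2 + 2 * h) * r) (by nlinarith)).trans (by rw [mul_pow, mul_assoc]))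
    rw [mem_ball]
    have h1 := (hann i p hp).2
    have h2 := hle i hi
    nlinarith
  obtain ⟨i, hi, hmin⟩ := Finset.exists_min_image (Finset.range N) (fun i => ν (B i))
    ⟨0, by simp [hN]⟩
  refine ⟨r + 3 * h * i, ⟨by have : 0 ≤ 3 * h * (i : ℝ) := by positivity
                             linarith, by linarith [hle i hi]⟩, ?_⟩
  have h1 : (N : ℝ≥0∞) * ν (B i) ≤ ENNReal.ofReal (C * (2 + 2 * h) ^ (k + 1) * r ^ (k + 1)) := by
    refine le_trans ?_ hsum
    have := Finset.card_nsmul_le_sum _ _ _ hmin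
    rwa [Finset.card_range, nsmul_eq_mul] at this
  have hN0 : (0 : ℝ) < N := by positivity
  calc ν (B i) ≤ ENNReal.ofReal (C * (2 + 2 * h) ^ (k + 1) * r ^ (k + 1)) / N := by
        rw [ENNReal.le_div_iff_mul_le (Or.inl (by positivity)) (Or.inl (ENNReal.natCast_ne_top N)),
          mul_comm]
        exact h1
    _ = ENNReal.ofReal (C * (2 + 2 * h) ^ (k + 1) * r ^ (k + 1) / N) := by
        rw [ENNReal.ofReal_div_of_pos hN0, ENNReal.ofReal_natCast]
    _ ≤ _ := by
        refine ENNReal.ofReal_le_ofReal ?_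
        rw [div_le_iff₀ hN0]
        rw [div_le_iff₀ (by positivity)] at hNr
        calc C * (2 + 2 * h) ^ (k + 1) * r ^ (k + 1)
            = C * (2 + 2 * h) ^ (k + 1) * r ^ k * r := by ring
          _ ≤ C * (2 + 2 * h) ^ (k + 1) * r ^ k * (N * (3 * h)) := by gcongr
          _ = C * (2 + 2 * h) ^ (k + 1) * (3 * h) * r ^ k * N := by ring
          _ ≤ _ := by gcongr; exact le_max_right _ _

lemma sphereGrowth (H : CoarseChart ν f D)
    (hX : PolynomialGrowth (Measure.count : Measure X) (k + 1)) (hG : IsGraphMetric G)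
    (hiso : BallIsoperimetry G k) {h : ℝ} (hh : AdmissibleScale Y h) : SphereGrowth ν h k := by
  have h0 : 0 < h := by
    obtain ⟨b, hb, -, hbh⟩ := hh
    linarith
  obtain ⟨c, hc, hlow⟩ := H.exists_le_measure_bdry_ball hX hG hiso hh
  obtain ⟨C, hC, hup⟩ := H.exists_measure_bdry_ball_le hX h0
  refine ⟨max C c⁻¹, hC.trans (le_max_left _ _), fun y r hr => ⟨?_, ?_⟩⟩
  · refine (ENNReal.ofReal_le_ofReal ?_).trans (hlow y r hr)
    gcongr
    exact inv_le_of_inv_le₀ hc (le_max_right _ _)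
  · obtain ⟨s, hs, hs'⟩ := hup y r hr
    refine ⟨s, hs, hs'.trans (ENNReal.ofReal_le_ofReal ?_)⟩
    gcongr
    exact le_max_left _ _

/-- A finite set is transported to the target, with control on its measure and its boundary. -/
lemma exists_transfer (H : CoarseChart ν f D)
    (hX : PolynomialGrowth (Measure.count : Measure X) d) (hG : IsGraphMetric G) {h : ℝ}
    (hh : 0 ≤ h) :
    ∃ K : ℝ≥0, 1 ≤ K ∧ ∀ A S : Finset X, innerBdry G A ⊆ S → ∃ A' : Set Y,
      MeasurableSet A' ∧ ν A' < ∞ ∧ (A.card : ℝ≥0∞) ≤ K * ν A' ∧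
        ν (bdry h A') ≤ K * S.card := by
  have hD := H.one_le
  have hD0 : (0 : ℝ) < D := by linarith
  set R : ℝ := D * (2 * D + h + 1 + D) with hR
  obtain ⟨K₁, hK₁, h1⟩ := H.exists_card_le_measure hX 0 hD0
  obtain ⟨K₂, h2⟩ := H.exists_measure_le_card D
  obtain ⟨K₃, h3⟩ := H.exists_measure_le_card (D + (D * (3 * R) + D))
  refine ⟨max K₁ K₃, hK₁.trans (le_max_left _ _), fun A S hS => ?_⟩
  have hopen : IsOpen (⋃ z ∈ A, ball (f z) (D : ℝ)) := isOpen_biUnion fun _ _ => isOpen_ball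
  refine ⟨⋃ z ∈ A, ball (f z) (D : ℝ), hopen.measurableSet, ?_, ?_, ?_⟩
  · refine (h2 A _ fun y hy => ?_).trans_lt
      (ENNReal.mul_lt_top ENNReal.coe_lt_top (ENNReal.natCast_lt_top _))
    obtain ⟨z, hz, hy⟩ := mem_iUnion₂.1 hy
    exact ⟨z, hz, hy⟩
  · refine (h1 A f _ (by simp) fun z hz => subset_iUnion₂_of_subset z hz subset_rfl).trans ?_
    gcongr
    exact le_max_left _ _
  · refine (h3 S _ fun y hy => ?_).trans (by gcongr; exact le_max_right _ _)
    obtain ⟨p, hp, hyp⟩ := exists_dist_lt_of_mem_cthickening (h' := h + 1) (by linarith)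
      (by linarith) hy.1
    obtain ⟨q, hq, hyq⟩ := exists_dist_lt_of_mem_cthickening (h' := h + 1) (by linarith)
      (by linarith) hy.2
    obtain ⟨a, ha, hpa⟩ := mem_iUnion₂.1 hp
    obtain ⟨w, hw⟩ := H.exists_near q
    -- The balls forming the set have radius D, the precision of `exists_near`; hence a point
    -- outside the set is near the image only of vertices outside `A`.
    have hwA : w ∉ A := fun h => hq (mem_iUnion₂.2 ⟨w, h, hw⟩)
    obtain ⟨z, hz⟩ := H.exists_near y
    rw [mem_ball] at hpa
    have hle : ∀ t b, dist y t < h + 1 → dist t (f b) < D → dist z b ≤ R := by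
      intro t b hyt htb
      refine (H.le_dist z b).trans (mul_le_mul_of_nonneg_left ?_ hD0.le)
      have := dist_triangle4 (f z) y t (f b)
      rw [dist_comm (f z) y] at this
      linarith
    have hza := hle p a hyp hpa
    have hzw := hle q w hyq hw
    -- A shortest path from a to w crosses the inner boundary at distance at most 2R from a, hence
    -- at most 3R from z.
    obtain ⟨b, hb, hab⟩ := hG.exists_mem_innerBdry (A := (A : Set X)) (x := a) (y := w) ha hwA
    refine ⟨b, hS hb, ?_⟩
    have h4 : dist z b ≤ 3 * R := by
      linarith [dist_triangle z a b, dist_triangle_left a w z]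
    have h5 := H.dist_le z b
    have h6 : (D : ℝ) * dist z b ≤ D * (3 * R) := mul_le_mul_of_nonneg_left h4 hD0.le
    linarith [dist_triangle y (f z) (f b)]

end CoarseChart

/-! ### Comparison of exponents and unboundedness of the profile -/

/-- If the sets of the family satisfy `μ (∂A) ≳ μ(A) ^ ((e + 1) / (e + 2))`, and there are sets of
measure about `q ^ (2 e + 3)` whose boundary is of the order of `q ^ (2 e + 1)`, for `q = 2 ^ k`,
then the family is not asymptotically isoperimetric. -/
lemma not_asympIsoperimetric {X : Type u} [MetricSpace X] [MeasurableSpace X] {μ : Measure X}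
    {h : ℝ} {𝒜 : Set (Set X)} {e : ℕ}
    (hlow : ∃ c T₀ : ℝ, 0 < c ∧ ∀ A ∈ 𝒜, ∀ T : ℝ, T₀ ≤ T →
      ENNReal.ofReal (T ^ (e + 2)) ≤ μ A → ENNReal.ofReal (c * T ^ (e + 1)) ≤ μ (bdry h A))
    (hup : ∃ a C : ℝ, 0 < a ∧ 0 < C ∧ ∀ k : ℕ, ∃ A : Set X, NullMeasurableSet A μ ∧ μ A < ∞ ∧
      ENNReal.ofReal (a * (2 ^ k) ^ (2 * e + 3)) ≤ μ A ∧
      μ (bdry h A) ≤ ENNReal.ofReal (C * (2 ^ k) ^ (2 * e + 1))) :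
    ¬ AsympIsoperimetric μ h 𝒜 := by
  rintro ⟨C₁, C₂, hC₁, hC₂, hle⟩
  obtain ⟨c, T₀, hc, hlow⟩ := hlow
  obtain ⟨a, C, ha, hC, hup⟩ := hup
  set α : ℝ := a / C₂ with hα
  have hα0 : 0 < α := by positivity
  -- The first bound on q = 2^k makes T at least T₀; the second contradicts the final inequality.
  obtain ⟨k, hk⟩ := pow_unbounded_of_one_lt
    (max ((max T₀ 0) ^ (e + 2) / α) ((C₁ * C) ^ (e + 2) / (c ^ (e + 2) * α ^ (e + 1))))
    (one_lt_two : (1 : ℝ) < 2)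
  set q : ℝ := 2 ^ k with hq
  have hq1 : 1 ≤ q := one_le_pow₀ (by norm_num)
  have hk1 := (le_max_left _ _).trans_lt hk
  have hk2 := (le_max_right _ _).trans_lt hk
  rw [div_lt_iff₀ (by positivity)] at hk1 hk2
  set t : ℝ := α * q ^ (2 * e + 3) with ht
  have ht0 : 0 < t := by positivity
  set T : ℝ := t ^ ((e + 2 : ℕ) : ℝ)⁻¹ with hT
  have hTpow : T ^ (e + 2) = t := Real.rpow_inv_natCast_pow ht0.le (by omega)
  have hT0 : 0 < T := Real.rpow_pos_of_pos ht0 _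
  have hTT : T₀ ≤ T := by
    refine (le_max_left T₀ 0).trans ?_
    refine le_of_pow_le_pow_left₀ (n := e + 2) (by omega) hT0.le ?_
    rw [hTpow, ht]
    have : q ≤ q ^ (2 * e + 3) := le_self_pow₀ hq1 (by omega)
    nlinarith
  have h1 : ENNReal.ofReal (c * T ^ (e + 1)) ≤ lowerProfile μ h 𝒜 t :=
    le_iInf₂ fun A hA => le_iInf fun hAt => hlow A hA T hTT (hTpow ▸ hAt)
  have h2 : profile μ h (C₂ * t) ≤ ENNReal.ofReal (C * q ^ (2 * e + 1)) := by
    obtain ⟨A, hA1, hA2, hA3, hA4⟩ := hup k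
    refine le_trans ?_ hA4
    refine iInf_le_of_le A (iInf_le_of_le hA1 (iInf_le_of_le hA2 (iInf_le_of_le ?_ le_rfl)))
    rwa [show C₂ * t = a * q ^ (2 * e + 3) by rw [ht, hα]; field_simp]
  have h3 : c * T ^ (e + 1) ≤ C₁ * (C * q ^ (2 * e + 1)) := by
    rw [← ENNReal.ofReal_le_ofReal_iff (by positivity), ENNReal.ofReal_mul hC₁.le]
    exact h1.trans ((hle t ht0).trans (by gcongr))
  -- Raising to the power e + 2 clears the root in T. The exponents of q are then (2e+3)(e+1) on the
  -- left and (2e+1)(e+2) on the right, so a single factor q remains on the left.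
  have h4 := pow_le_pow_left₀ (by positivity) h3 (e + 2)
  have h5 : (c * T ^ (e + 1)) ^ (e + 2) =
      q * (c ^ (e + 2) * α ^ (e + 1)) * q ^ ((2 * e + 1) * (e + 2)) := by
    rw [mul_pow, ← pow_mul, mul_comm (e + 1), pow_mul, hTpow, ht]
    ring
  have h6 : (C₁ * (C * q ^ (2 * e + 1))) ^ (e + 2) =
      (C₁ * C) ^ (e + 2) * q ^ ((2 * e + 1) * (e + 2)) := by
    rw [← mul_assoc, mul_pow, ← pow_mul]
  rw [h5, h6] at h4
  exact absurd (le_of_mul_le_mul_right h4 (by positivity)) (not_le.2 hk2)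

/-- If balls are isoperimetric, sets of large finite volume have large boundary: each of their
points is at bounded distance from the boundary. -/
lemma BallIsoperimetry.unboundedProfile {X : Type u} [MetricSpace X] [MeasurableSpace X]
    [BorelSpace X] {G : SimpleGraph X} {d k : ℕ} (hiso : BallIsoperimetry G (k + 1))
    (hX : PolynomialGrowth (Measure.count : Measure X) d) (hG : IsGraphMetric G) {h : ℝ}
    (hh : 1 ≤ h) : UnboundedProfile (Measure.count : Measure X) h := by
  classical
  intro M
  obtain ⟨N, hN⟩ := exists_nat_gt M
  obtain ⟨c, hc, hiso⟩ := hiso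
  -- A ball of radius `R` inside `A` would already force N boundary points.
  set R : ℝ := max 1 (N / c) with hR
  have hR1 : 1 ≤ R := le_max_left _ _
  have hcR : N ≤ c * R ^ (k + 1) := by
    have h1 : N / c ≤ R := le_max_right _ _
    rw [div_le_iff₀ hc] at h1
    have h2 : R ≤ R ^ (k + 1) := le_self_pow₀ hR1 (by omega)
    nlinarith
  obtain ⟨N', hN'⟩ := hX.exists_card_le_nat R
  refine ⟨N * N' + 1, by positivity, lt_of_lt_of_le (b := (N : ℝ≥0∞)) (by exact_mod_cast hN)
    (le_iInf fun A => le_iInf fun _ => le_iInf fun hA => le_iInf fun hAt => ?_)⟩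
  have hfin : A.Finite := Measure.count_apply_lt_top.1 hA
  lift A to Finset X using hfin
  have hbfin : (innerBdry G (A : Set X)).Finite := A.finite_toSet.subset fun z hz => hz.1
  set I := hbfin.toFinset with hI
  have hI' : (I : Set X) = innerBdry G A := hbfin.coe_toFinset
  suffices hNI : N ≤ I.card by
    calc (N : ℝ≥0∞) ≤ I.card := by exact_mod_cast hNI
      _ = Measure.count (I : Set X) := (Measure.count_apply_finset I).symm
      _ ≤ _ := measure_mono (hI' ▸ hG.innerBdry_subset_bdry hh _)
  by_contra! hcon
  -- With fewer than N boundary points, no ball of radius `R` fits in `A`, so `A` is covered by the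
  -- `R`-balls about its inner boundary and has at most N N' points.
  have hnear : ∀ x ∈ A, ∃ z ∈ I, dist x z < R := by
    intro x hx
    have hnot : ¬ ball x R ⊆ A := fun hsub => by
      obtain ⟨S, hS, hcard⟩ := hiso x R (by linarith) A A.finite_toSet hsub
      have h1 : S.card ≤ I.card := Finset.card_le_card (by
        rw [← Finset.coe_subset, hI']; exact hS)
      have h2 : (N : ℝ) ≤ S.card := hcR.trans hcard
      have h3 : N ≤ S.card := by exact_mod_cast h2
      omega
    obtain ⟨y, hy, hyA⟩ := not_subset.1 hnot
    obtain ⟨z, hz, hxz⟩ := hG.exists_mem_innerBdry (A := (A : Set X)) hx hyA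
    rw [mem_ball, dist_comm] at hy
    exact ⟨z, by rwa [← Finset.mem_coe, hI'], hxz.trans_lt hy⟩
  have hcard : A.card ≤ I.card * N' := by
    have hsub : A ⊆ I.biUnion fun z => A.filter fun x => dist x z < R := fun x hx => by
      obtain ⟨z, hz, hxz⟩ := hnear x hx
      exact Finset.mem_biUnion.2 ⟨z, hz, Finset.mem_filter.2 ⟨hx, hxz⟩⟩
    refine (Finset.card_le_card hsub).trans (Finset.card_biUnion_le_card_mul _ _ _ fun z _ => ?_)
    exact hN' z _ fun x hx => (Finset.mem_filter.1 (Finset.mem_coe.1 hx)).2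
  rw [Measure.count_apply_finset, ← ENNReal.ofReal_natCast,
    ENNReal.ofReal_le_ofReal_iff (by positivity)] at hAt
  have h1 : N * N' + 1 ≤ A.card := by exact_mod_cast hAt
  have h2 : I.card * N' ≤ N * N' := Nat.mul_le_mul_right _ hcon.le
  omega

lemma le_mul_of_pow_le {C T r : ℝ} {d : ℕ} (hC : 1 ≤ C) (hd : d ≠ 0) (hr : 0 ≤ r)
    (h : T ^ d ≤ C * r ^ d) : T ≤ C * r := by
  refine le_of_pow_le_pow_left₀ hd (by positivity) (h.trans ?_)
  rw [mul_pow]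
  gcongr
  exact le_self_pow₀ hC hd

/-! ### Slabs against balls, and the conclusion -/

section Slabs

variable {e : ℕ} {Y : Type v} [MetricSpace Y] [MeasurableSpace Y] [BorelSpace Y] {ν : Measure Y}
  {f : WallLattice (e + 1) → Y} {D : ℝ≥0}

lemma CoarseChart.exists_slab_image (H : CoarseChart ν f D) {h : ℝ} (hh : 0 ≤ h) :
    ∃ a C : ℝ, 0 < a ∧ 0 < C ∧ ∀ k : ℕ, ∃ A : Set Y, NullMeasurableSet A ν ∧ ν A < ∞ ∧
      ENNReal.ofReal (a * (2 ^ k) ^ (2 * e + 3)) ≤ ν A ∧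
      ν (bdry h A) ≤ ENNReal.ofReal (C * (2 ^ k) ^ (2 * e + 1)) := by
  obtain ⟨K, hK1, hK⟩ := H.exists_transfer (WallLattice.polynomialGrowth (e + 1))
    (WallLattice.isGraphMetric (e + 1)) hh
  have hK0 : (0 : ℝ) < K := by exact_mod_cast zero_lt_one.trans_le hK1
  refine ⟨(K : ℝ)⁻¹, K * (2 * (e + 1) + 2), by positivity, by positivity, fun k => ?_⟩
  obtain ⟨S, hS, hcard⟩ := WallLattice.exists_innerBdry_slab_subset e k
  obtain ⟨A, hA1, hA2, hA3, hA4⟩ := hK _ S hS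
  refine ⟨A, hA1.nullMeasurableSet, hA2, ?_, hA4.trans ?_⟩
  · rw [WallLattice.card_slab] at hA3
    rw [inv_mul_eq_div, ENNReal.ofReal_div_of_pos hK0, ENNReal.ofReal_coe_nnreal]
    refine ENNReal.div_le_of_le_mul' (le_trans (le_of_eq ?_) hA3)
    rw [← ENNReal.ofReal_natCast]
    push_cast
    rfl
  · rw [← ENNReal.ofReal_coe_nnreal, ← ENNReal.ofReal_natCast, ← ENNReal.ofReal_mul hK0.le,
      mul_assoc (K : ℝ)]
    gcongr
    exact_mod_cast hcard

lemma CoarseChart.nib (H : CoarseChart ν f D) : NIB ν := by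
  have hX := WallLattice.polynomialGrowth (e + 1)
  have hG := WallLattice.isGraphMetric (e + 1)
  refine ⟨H.exists_admissibleScale hG, fun h hh => ?_⟩
  have h0 : 0 < h := by
    obtain ⟨b, hb, -, hbh⟩ := hh
    linarith
  refine not_asympIsoperimetric (e := e) ?_ (H.exists_slab_image h0.le)
  obtain ⟨c, hc, hlow⟩ := H.exists_le_measure_bdry_ball hX hG (WallLattice.ballIsoperimetry e) hh
  obtain ⟨C, hC, hball⟩ := H.exists_measure_ball_le_pow hX
  -- The threshold C + 1 excludes balls of radius below 1, whose measure is at most C; for the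
  -- others, T ≤ C r turns the bound in r into one in T.
  refine ⟨c / C ^ (e + 1), C + 1, by positivity, ?_⟩
  rintro _ ⟨y, r, hr, rfl⟩ T hT hTA
  have key : ∀ s : ℝ, 1 ≤ s → r ≤ s → T ≤ C * s := fun s hs hrs => by
    have h1 := hTA.trans ((measure_mono (ball_subset_ball hrs)).trans (hball y s hs))
    rw [ENNReal.ofReal_le_ofReal_iff (by positivity)] at h1
    exact le_mul_of_pow_le hC (by omega) (by linarith) h1
  have hr1 : 1 ≤ r := by
    by_contra! hcon
    have := key 1 le_rfl hcon.le
    linarith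
  refine (ENNReal.ofReal_le_ofReal ?_).trans (hlow y r hr1)
  have h1 := key r hr1 le_rfl
  have h2 : 0 ≤ T := by linarith
  rw [div_mul_eq_mul_div, mul_div_assoc, ← div_pow]
  gcongr
  rw [div_le_iff₀ (by linarith)]
  linarith

end Slabs

/-- With the identity chart, `exists_slab_image` bounds the h-boundary of competitors in the graph
itself, at every scale h ≥ 0. -/
lemma WallLattice.coarseChart_id (e : ℕ) :
    CoarseChart (Measure.count : Measure (WallLattice e)) id 1 := by
  have hone : ∀ x, (Measure.count : Measure (WallLattice e)) (ball x 1) = 1 := fun x => by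
    rw [(isGraphMetric e).ball_one, Measure.count_singleton]
  refine ⟨by simp, fun y => ⟨y, by simp⟩, fun x x' => by simp, fun x x' => by simp, ?_,
    fun x => by simp [hone], fun x => by simp [hone]⟩
  intro r hr
  obtain ⟨N, hN⟩ := (polynomialGrowth e).exists_card_le_nat (2 * r)
  refine ⟨N, fun x => ?_⟩
  have hfin := (polynomialGrowth e).finite_ball x (2 * r)
  rw [Measure.count_apply_finite _ hfin]
  calc (hfin.toFinset.card : ℝ≥0∞) ≤ N := by exact_mod_cast hN x _ (by simp)
    _ = (N : ℝ≥0) * Measure.count {x} := by rw [Measure.count_singleton, mul_one]; simp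
    _ ≤ _ := by gcongr; exact singleton_subset_iff.2 (mem_ball_self hr)

lemma WallLattice.not_sandwichedByBalls {e : ℕ} {h : ℝ} (hh : 1 ≤ h)
    {A : ℕ → Set (WallLattice (e + 1))}
    (hA : IsoperimetricSequence (Measure.count : Measure (WallLattice (e + 1))) h A) :
    ¬ SandwichedByBalls A := by
  rintro ⟨x, x', r, r', C, hr, hC, hsub⟩
  obtain ⟨hfin, -, hasymp⟩ := hA
  refine not_asympIsoperimetric (e := e) ?_
    ((coarseChart_id (e + 1)).exists_slab_image (by linarith)) hasymp
  obtain ⟨c, hc, hiso⟩ := ballIsoperimetry e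
  obtain ⟨K, hK, hgrowth⟩ := polynomialGrowth (e + 1)
  have hC' : (0 : ℝ) < max C 1 := by positivity
  -- The outer ball bounds the volume, T ≤ K r', and the inner one bounds the boundary below in
  -- terms of r; r' ≤ max(C, 1) r links the two.
  refine ⟨c / (K * max C 1) ^ (e + 1), K + 1, by positivity, ?_⟩
  rintro _ ⟨n, rfl⟩ T hT hTA
  have key : ∀ s : ℝ, 1 ≤ s → r' n ≤ s → T ≤ K * s := fun s hs hrs => by
    have h1 := hTA.trans ((measure_mono ((hsub n).2.trans (ball_subset_ball hrs))).trans
      (hgrowth (x' n) s hs).2)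
    rw [ENNReal.ofReal_le_ofReal_iff (by positivity)] at h1
    exact le_mul_of_pow_le hK (by omega) (by linarith) h1
  have hr1 : 1 ≤ r' n := by
    by_contra! hcon
    have := key 1 le_rfl hcon.le
    linarith
  have h1 := key _ hr1 le_rfl
  have h2 : r' n ≤ max C 1 * r n := by
    rw [← div_le_iff₀ (hr n)]
    exact (hC n).trans (le_max_left _ _)
  obtain ⟨S, hS, hcard⟩ := hiso (x n) (r n) (hr n) (A n)
    (Measure.count_apply_lt_top.1 (hfin n).2) (hsub n).1
  calc ENNReal.ofReal (c / (K * max C 1) ^ (e + 1) * T ^ (e + 1)) ≤ ENNReal.ofReal S.card := by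
        refine ENNReal.ofReal_le_ofReal (le_trans ?_ hcard)
        have h3 : 0 ≤ T := by linarith
        rw [div_mul_eq_mul_div, mul_div_assoc, ← div_pow]
        gcongr
        rw [div_le_iff₀ (by positivity)]
        nlinarith
    _ = Measure.count (S : Set (WallLattice (e + 1))) := by
        rw [Measure.count_apply_finset, ENNReal.ofReal_natCast]
    _ ≤ _ := measure_mono (hS.trans ((isGraphMetric (e + 1)).innerBdry_subset_bdry hh _))

end Isoperimetry

end

theorem mainTheorem8 (d : ℕ) (hd : 2 ≤ d) :
    ∃ (V : Type) (_ : MetricSpace V) (_ : MeasurableSpace V) (_ : BorelSpace V)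
      (G : SimpleGraph V),
      Isoperimetry.IsGraphMetric G ∧
      Isoperimetry.PolynomialGrowth (Measure.count : Measure V) d ∧
      (∀ h : ℝ, 1 ≤ h → Isoperimetry.UnboundedProfile (Measure.count : Measure V) h) ∧
      Isoperimetry.StablyNIB.{0, u} (Measure.count : Measure V) ∧
      (∀ h : ℝ, 1 ≤ h → ∀ A : ℕ → Set V,
        Isoperimetry.IsoperimetricSequence (Measure.count : Measure V) h A →
          ¬ Isoperimetry.SandwichedByBalls A) ∧
      (∀ (Y : Type u) [MetricSpace Y] [MeasurableSpace Y] [BorelSpace Y] (ν : Measure Y)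
        [SigmaFinite ν],
        Isoperimetry.LargeScaleEquivalent (Measure.count : Measure V) ν →
          Isoperimetry.NIB ν ∧
          ∀ h : ℝ, Isoperimetry.AdmissibleScale Y h → Isoperimetry.SphereGrowth ν h (d - 1)) := by
  -- One vertical direction and e + 1 horizontal ones; at least one horizontal direction is needed
  -- for lines that avoid the walls.
  obtain ⟨e, rfl⟩ : ∃ e, d = e + 2 := ⟨d - 2, by omega⟩
  have hG := Isoperimetry.WallLattice.isGraphMetric (e + 1)
  have hX := Isoperimetry.WallLattice.polynomialGrowth (e + 1)
  have hiso := Isoperimetry.WallLattice.ballIsoperimetry e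
  refine ⟨Isoperimetry.WallLattice (e + 1), inferInstance, inferInstance, inferInstance,
    Isoperimetry.WallLattice.graph (e + 1), hG, hX, fun h hh => hiso.unboundedProfile hX hG hh,
    ?_, fun h hh A hA => Isoperimetry.WallLattice.not_sandwichedByBalls hh hA, ?_⟩
  · intro Y _ _ _ ν _ _ hν
    obtain ⟨f, D, H⟩ := hν.exists_coarseChart hG
    exact H.nib
  · intro Y _ _ _ ν _ hν
    obtain ⟨f, D, H⟩ := hν.exists_coarseChart hG
    exact ⟨H.nib, fun h hh => H.sphereGrowth hX hG hiso hh⟩
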